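/- Let $\Sigma$ be a finite non-empty set and let $\ell:\Sigma\times\Sigma\to\{2,3,\dots\}\cup\{\infty\}$ be symmetric (its values on the diagonal are irrelevant). The Artin–Tits monoid $\mathbf A=\mathbf A(\Sigma,\ell)$ is the monoid generated by $\Sigma$ with the relations $aba\cdots=bab\cdots$ (both words of length $\ell(a,b)$) for all $a\neq b$ with $\ell(a,b)<\infty$. It is called irreducible if it is not isomorphic to the direct product of two Artin–Tits monoids. Write $x\le_{\mathrm l}y$ if $y=xz$ for some $z\in\mathbf A$, and $x\le_{\mathrm r}y$ if $y=zx$ for some $z\in\mathbf A$; let $\bigvee_{\mathrm l}$ denote least upper bounds for $\le_{\mathrm l}$. The monoid $\mathbf A$ has spherical type if $\Delta=\bigvee_{\mathrm l}\Sigma$ exists; $\Delta$ is then called its Garside element. Let $\mathcal S$, the set of simple elements, be the smallest subset of $\mathbf A$ that contains $\Sigma$, is downward closed under $\le_{\mathrm r}$, and contains $\bigvee_{\mathrm l}\{a,b\}$ whenever it contains $a$ and $b$ and this least upper bound exists. For $x,y\in\mathcal S$ write $x\to y$ if $x=\bigvee_{\mathrm l}\{\zeta\in\mathcal S:\zeta\le_{\mathrm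 l}xy\}$. A sequence $(x_1,\dots,x_k)$, $k\ge1$, of elements of $\mathcal S$ is normal if $x_i=\bigvee_{\mathrm l}\{\zeta\in\mathcal S:\zeta\le_{\mathrm l}x_i\cdots x_k\}$ for all $1\le i\le k$. The Charney graph of $\mathbf A$ is the directed graph whose vertices are the elements of $\mathcal S$ other than the unit and, if $\mathbf A$ has spherical type, other than $\Delta$, and whose edges are the pairs $(x,y)$ of vertices with $x\to y$. **Theorem.** Let $\mathbf A$ be an irreducible Artin–Tits monoid. 1. The Charney graph of $\mathbf A$ is strongly connected: for any two vertices $x,y$ there is a (possibly empty) directed path from $x$ to $y$ in the graph. 2. Let $a,b\in\mathcal S$ be different from the unit. If $\mathbf A$ does not have spherical type, or $a=\Delta$, or $b\neq\Delta$, then there is a normal sequence $(x_1,\dots,x_k)$ with $x_1=a$ and $x_k=b$. -/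

import Mathlib

universe u

/-- The defining relations of the Artin–Tits monoid of a Coxeter matrix `M` on the alphabet `B`.
As usual for Mathlib's Coxeter matrices, the entry `0` stands for `∞`, and off-diagonal entries
are different from `1`. For distinct letters `a`, `b` with `M a b` finite, the two alternating
words in `a`, `b` of length `M a b` (one ending in `b`, the other ending in `a`) are identified. -/
inductive ArtinTitsRel {B : Type u} (M : CoxeterMatrix B) : FreeMonoid B → FreeMonoid B → Prop
  | braid (a b : B) (hne : a ≠ b) (hfin : M a b ≠ 0) :
      ArtinTitsRel M (FreeMonoid.ofList (CoxeterSystem.alternatingWord a b (M a b)))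
        (FreeMonoid.ofList (CoxeterSystem.alternatingWord b a (M a b)))

/-- The Artin–Tits monoid with generators `B` and exponents given by `M`. -/
abbrev ArtinTitsMonoid {B : Type u} (M : CoxeterMatrix B) : Type u :=
  PresentedMonoid (ArtinTitsRel M)

namespace ArtinTitsMonoid

variable {B : Type u} (M : CoxeterMatrix B)

/-- The set of generators, as a subset of the monoid. -/
def generators : Set (ArtinTitsMonoid M) :=
  Set.range (PresentedMonoid.of (ArtinTitsRel M))

/-- An Artin–Tits monoid is irreducible if it is not isomorphic to the direct product of two
Artin–Tits monoids (each over a finite, nonempty alphabet). -/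
def IsIrreducible : Prop :=
  ∀ (B₁ B₂ : Type u) [Finite B₁] [Nonempty B₁] [Finite B₂] [Nonempty B₂]
    (M₁ : CoxeterMatrix B₁) (M₂ : CoxeterMatrix B₂),
    IsEmpty (ArtinTitsMonoid M ≃* ArtinTitsMonoid M₁ × ArtinTitsMonoid M₂)

variable {M}

/-- Left divisibility: `x` is a prefix of `y`. -/
def LeftDvd (x y : ArtinTitsMonoid M) : Prop := ∃ z, y = x * z

/-- Right divisibility: `x` is a suffix of `y`. -/
def RightDvd (x y : ArtinTitsMonoid M) : Prop := ∃ z, y = z * x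

/-- `u` is the least upper bound of the set `X` for left divisibility. -/
def IsLeftLub (X : Set (ArtinTitsMonoid M)) (u : ArtinTitsMonoid M) : Prop :=
  (∀ x ∈ X, LeftDvd x u) ∧ ∀ v, (∀ x ∈ X, LeftDvd x v) → LeftDvd u v

/-- `d` is the Garside element `Δ`, the left least upper bound of the generators. -/
def IsGarsideElement (d : ArtinTitsMonoid M) : Prop := IsLeftLub (generators M) d

variable (M)

/-- The monoid has spherical type if the Garside element exists. -/
def IsSpherical : Prop := ∃ d : ArtinTitsMonoid M, IsGarsideElement d

variable {M}

/-- A Garside subset contains the generators, is closed under existing binary left least upper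
bounds, and is downward closed under right divisibility. -/
structure IsGarsideSubset (G : Set (ArtinTitsMonoid M)) : Prop where
  generators_subset : generators M ⊆ G
  lub_mem : ∀ a ∈ G, ∀ b ∈ G, ∀ c, IsLeftLub {a, b} c → c ∈ G
  rightDvd_mem : ∀ x ∈ G, ∀ y, RightDvd y x → y ∈ G

variable (M)

/-- The set of simple elements: the smallest Garside subset. -/
def simples : Set (ArtinTitsMonoid M) := ⋂₀ {G | IsGarsideSubset G}

theorem simples_isLeast : IsLeast {G | IsGarsideSubset G} (simples M) := by
  refine ⟨⟨?_, ?_, ?_⟩, fun G hG => Set.sInter_subset_of_mem hG⟩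
  · exact fun x hx G hG => hG.generators_subset hx
  · exact fun a ha b hb c hc G hG => hG.lub_mem a (ha G hG) b (hb G hG) c hc
  · exact fun x hx y hy G hG => hG.rightDvd_mem x (hx G hG) y hy

variable {M}

/-- The sequence `l = (x₁, …, x_k)`, `k ≥ 1`, is normal: each `x_i` is simple, and `x_i` is the
left least upper bound of the simple left divisors of `x_i ⋯ x_k`. -/
def IsNormalSeq (l : List (ArtinTitsMonoid M)) : Prop :=
  l ≠ [] ∧ ∀ (i : ℕ) (hi : i < l.length),
    l[i] ∈ simples M ∧ IsLeftLub {z | z ∈ simples M ∧ LeftDvd z (l.drop i).prod} l[i]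

/-- The relation `x → y` (for simple `x`, `y`): `x` is the left least upper bound of the simple
left divisors of `x * y`. -/
def NormalRel (x y : ArtinTitsMonoid M) : Prop :=
  IsLeftLub {z | z ∈ simples M ∧ LeftDvd z (x * y)} x

variable (M)

/-- The vertices of the Charney graph: the simple elements other than the unit and, in spherical
type, the Garside element. -/
def CharneyGraph : Type u :=
  {x : ArtinTitsMonoid M // x ∈ simples M ∧ x ≠ 1 ∧ ¬ IsGarsideElement x}

/-- The edges of the Charney graph are given by the relation `x → y`. -/
instance : Quiver (CharneyGraph M) where
  Hom x y := PLift (NormalRel x.1 y.1)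

end ArtinTitsMonoid

/-! The edges rest on one criterion (`normalRel_of_gen_dvd`): `x → y` as soon as every generator
dividing `y` on the left divides `x` on the right, because a longer simple `x * u` would contain the
square of a generator, whereas simple elements are reduced. So a vertex ending in `s` has an edge to
the generator `s`, and it remains to reach an arbitrary vertex `y` from `s`. This is done backwards
from `y`, remembering only a proper set `I` of generators that contains the left divisors of `y`.
For `b ∉ I`, `exists_normalRel` builds a predecessor of `y` whose generators on the left are among
`b` and the members of `I` commuting with `b`. What is left is a game on the Coxeter graph: insert a
vertex `b`, remove its neighbours. Irreducibility makes the graph connected (`splitEquiv`), and then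
`move_induction` brings `I` down to a singleton, which can be slid along a path to `{s}`. For normal
sequences, normality is a local condition (`NormalRel.isHead_mul`), so paths are normal sequences;
and `Δ` is right divisible by all generators, so `Δ → b` always. The divisibility theory comes from
the Coxeter group. The geometric representation gives the order of a product of two simple
reflections; a parity action gives the exchange property and the word property; a confluence
argument in the weak order gives each element of the monoid a greatest reduced left divisor. Left
cancellation, conditional least common multiples and the reducedness of simple elements follow. -/

open Polynomial.Chebyshev in
theorem eval_chebyshevS_two_mul_cos (n : ℤ) (φ : ℝ) :
    (S ℝ n).eval (2 * Real.cos φ) * Real.sin φ = Real.sin ((n + 1) * φ) := by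
  rw [← U_real_cos, ← S_comp_two_mul_X]
  simp

/-! ### The geometric representation and the orders of products of two simple reflections. -/

namespace CoxeterMatrix

universe v

variable {B : Type v} (M : CoxeterMatrix B)

/-- Twice the inner product with the `i`-th simple root, in the geometric representation. -/
noncomputable def simpleCoroot (i : B) : Module.Dual ℝ (B →₀ ℝ) :=
  Finsupp.linearCombination ℝ fun j => -2 * Real.cos (Real.pi / M i j)

/-- The `i`-th simple root of the geometric representation. -/
noncomputable def simpleRoot (i : B) : B →₀ ℝ := Finsupp.single i 1

/-- The value also covers the label `∞`: there `M i j = 0`, division by zero gives `0`, and the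
pairing is `-2`. -/
theorem simpleCoroot_simpleRoot (i j : B) :
    M.simpleCoroot i (simpleRoot j) = -2 * Real.cos (Real.pi / M i j) := by
  simp [simpleCoroot, simpleRoot]

theorem simpleCoroot_simpleRoot_self (i : B) : M.simpleCoroot i (simpleRoot i) = 2 := by
  simp [simpleCoroot_simpleRoot]

/-- The simple reflections of the geometric representation. -/
noncomputable def geomReflection (i : B) : (B →₀ ℝ) ≃ₗ[ℝ] (B →₀ ℝ) :=
  Module.reflection (M.simpleCoroot_simpleRoot_self i)

/-- The left side is the trace of the product of the two reflections on a plane, the right side that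
of a rotation by `2π / m`. It is the parameter at which the Chebyshev polynomials describing the
powers are evaluated. -/
theorem geom_trace (i j : B) :
    M.simpleCoroot i (simpleRoot j) * M.simpleCoroot j (simpleRoot i) - 2 =
      2 * Real.cos (2 * (Real.pi / M i j)) := by
  rw [simpleCoroot_simpleRoot, simpleCoroot_simpleRoot, M.symmetric j i, Real.cos_two_mul]
  ring

theorem sin_two_mul_pi_div_pos {m : ℕ} (hm : 3 ≤ m) : 0 < Real.sin (2 * (Real.pi / m)) := by
  have hm' : (3 : ℝ) ≤ m := by exact_mod_cast hm
  apply Real.sin_pos_of_pos_of_lt_pi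
  · positivity
  · rw [mul_div_assoc', div_lt_iff₀ (by linarith)]
    nlinarith [Real.pi_pos]

open Polynomial.Chebyshev in
theorem isLiftable_geomReflection : M.IsLiftable M.geomReflection := by
  intro i j
  obtain h0 | h1 | h2 | h3 : M i j = 0 ∨ M i j = 1 ∨ M i j = 2 ∨ 3 ≤ M i j := by omega
  · rw [h0, pow_zero]
  · have : i = j := by
      by_contra h
      exact M.off_diagonal i j h h1
    subst this
    rw [h1, pow_one]
    ext1 z
    rw [LinearEquiv.mul_apply, LinearEquiv.coe_one, id_eq]
    exact Module.involutive_reflection (M.simpleCoroot_simpleRoot_self i) z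
  · have hij : M.simpleCoroot i (simpleRoot j) = 0 := by simp [simpleCoroot_simpleRoot, h2]
    have hji : M.simpleCoroot j (simpleRoot i) = 0 := by
      simp [simpleCoroot_simpleRoot, M.symmetric j i, h2]
    rw [h2, pow_two]
    ext1 z
    simp only [geomReflection, LinearEquiv.mul_apply, Module.reflection_apply, map_sub, map_smul,
      hij, hji, simpleCoroot_simpleRoot_self, LinearEquiv.coe_one, id_eq]
    module
  -- Now `sin φ ≠ 0` for `φ = 2π / m`, so vanishing can be tested after multiplication by `sin φ`;
  -- this fails for `m = 2`, hence the separate case. The factor that vanishes is `S (k - 1)` if `m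
  -- = 2k`, and `S k + S (k - 1)` if `m = 2k + 1`.
  · set m := M i j with hm
    have hs := (sin_two_mul_pi_div_pos h3).ne'
    have hmθ : (m : ℝ) * (2 * (Real.pi / m)) = 2 * Real.pi := by
      have : (m : ℝ) ≠ 0 := by positivity
      field_simp
    ext1 z
    rw [geomReflection, geomReflection,
      Module.reflection_mul_reflection_pow_apply _ _ m z _ (M.geom_trace i j).symm, ← hm]
    generalize hφ : 2 * (Real.pi / (m : ℝ)) = φ at *
    obtain ⟨k, hk | hk⟩ := Nat.even_or_odd' m
    · have e1 : ((m : ℤ) - 2) / 2 = k - 1 := by omega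
      have e2 : ((m : ℤ) - 1) / 2 = k - 1 := by omega
      have h : (S ℝ ((k : ℤ) - 1)).eval (2 * Real.cos φ) = 0 := by
        apply (mul_eq_zero.mp _).resolve_right hs
        rw [eval_chebyshevS_two_mul_cos]
        have : ((((k : ℤ) - 1 : ℤ) : ℝ) + 1) * φ = Real.pi := by
          rw [hk] at hmθ
          push_cast at hmθ ⊢
          linarith
        rw [this, Real.sin_pi]
      rw [e1, e2, h]
      simp
    · have e1 : ((m : ℤ) - 2) / 2 = k - 1 := by omega
      have e2 : ((m : ℤ) - 1) / 2 = k := by omega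
      have e3 : ((m : ℤ) - 3) / 2 = k - 1 := by omega
      have e4 : (m : ℤ) / 2 = k := by omega
      have h : (S ℝ (k : ℤ)).eval (2 * Real.cos φ) +
          (S ℝ ((k : ℤ) - 1)).eval (2 * Real.cos φ) = 0 := by
        apply (mul_eq_zero.mp _).resolve_right hs
        rw [add_mul, eval_chebyshevS_two_mul_cos, eval_chebyshevS_two_mul_cos]
        have : ((((k : ℤ) - 1 : ℤ) : ℝ) + 1) * φ = 2 * Real.pi - (((k : ℤ) : ℝ) + 1) * φ := by
          rw [hk] at hmθ
          push_cast at hmθ ⊢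
          linarith
        rw [this, Real.sin_two_pi_sub]
        ring
      rw [e1, e2, e3, e4, h]
      simp

-- Compare coordinates of the image of the `i`-th simple root. For `∞` the `j`-th coordinate grows
-- linearly with `k`; for label `2` the root is negated; otherwise a fixed root would force `cos (k
-- φ) = 1` with `0 < k φ < 2π`.
open Polynomial.Chebyshev in
theorem geomReflection_mul_pow_ne_one {i j : B} (hij : i ≠ j) {k : ℕ} (hk : 0 < k)
    (hkm : M i j ≠ 0 → k < M i j) : (M.geomReflection i * M.geomReflection j) ^ k ≠ 1 := by
  intro h
  have hx := congrArg (fun f => f (simpleRoot i)) h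
  simp only [geomReflection] at hx
  rw [Module.reflection_mul_reflection_pow_apply_self _ _ k _ (M.geom_trace i j).symm] at hx
  have hi := DFunLike.congr_fun hx i
  have hj := DFunLike.congr_fun hx j
  simp only [simpleRoot, Finsupp.coe_add, Finsupp.coe_smul, Pi.add_apply, Pi.smul_apply,
    Finsupp.single_eq_same, Finsupp.single_eq_of_ne hij, Finsupp.single_eq_of_ne hij.symm,
    smul_eq_mul, mul_one, mul_zero, add_zero, zero_add, LinearEquiv.coe_one, id_eq] at hi hj
  change _ * - M.simpleCoroot j (simpleRoot i) = 0 at hj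
  rw [simpleCoroot_simpleRoot, M.symmetric j i] at hj
  have h1 := M.off_diagonal i j hij
  obtain h0 | h2 | h3 : M i j = 0 ∨ M i j = 2 ∨ 3 ≤ M i j := by omega
  · simp only [h0, Nat.cast_zero, div_zero, mul_zero, Real.cos_zero, mul_one, S_eval_two] at hj
    push_cast at hj
    have : (k : ℝ) ≠ 0 := by positivity
    apply this
    linarith
  · have : k = 1 := by have := hkm (by omega); omega
    subst this
    have : 2 * (Real.pi / ((2 : ℕ) : ℝ)) = Real.pi := by push_cast; ring
    simp only [h2, this, Real.cos_pi, Nat.cast_one, S_one, sub_self, S_zero] at hi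
    norm_num at hi
  · have hkm := hkm (by omega)
    set m := M i j with hm
    have hs := (sin_two_mul_pi_div_pos h3).ne'
    have hm0 : (3 : ℝ) ≤ m := by exact_mod_cast h3
    have hmθ : (m : ℝ) * (2 * (Real.pi / m)) = 2 * Real.pi := by
      field_simp
    have hcos : 0 < Real.cos (Real.pi / m) := by
      apply Real.cos_pos_of_mem_Ioo
      have : 0 < Real.pi / m := by positivity
      constructor
      · linarith [Real.pi_pos]
      · rw [div_lt_div_iff₀ (by linarith) (by norm_num)]
        nlinarith [Real.pi_pos]
    generalize hφ : 2 * (Real.pi / (m : ℝ)) = φ at *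
    have hSk : (S ℝ ((k : ℤ) - 1)).eval (2 * Real.cos φ) = 0 :=
      (mul_eq_zero.mp hj).resolve_right (by linarith)
    rw [hSk, add_zero] at hi
    have e1 := eval_chebyshevS_two_mul_cos k φ
    have e2 := eval_chebyshevS_two_mul_cos (k - 1) φ
    rw [hSk, zero_mul] at e2
    rw [hi, one_mul] at e1
    push_cast at e1 e2
    rw [sub_add_cancel] at e2
    rw [add_mul, one_mul, Real.sin_add, ← e2, zero_mul, zero_add] at e1
    have hck : Real.cos (k * φ) = 1 := mul_right_cancel₀ hs (by linarith)
    have hk' : (k : ℝ) < m := by exact_mod_cast hkm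
    have hk0 : (0 : ℝ) < k := by exact_mod_cast hk
    have hφ0 : 0 < φ := by rw [← hφ]; positivity
    have hlt : k * φ < 2 * Real.pi := by rw [← hmθ]; gcongr
    have := (Real.cos_eq_one_iff_of_lt_of_lt (by nlinarith) hlt).mp hck
    nlinarith

variable {M} {W : Type*} [Group W]

theorem _root_.CoxeterSystem.simple_mul_simple_pow_ne_one (cs : CoxeterSystem M W) {i j : B}
    (hij : i ≠ j) {k : ℕ} (hk : 0 < k) (hkm : M i j ≠ 0 → k < M i j) :
    (cs.simple i * cs.simple j) ^ k ≠ 1 := by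
  intro h
  apply M.geomReflection_mul_pow_ne_one hij hk hkm
  have := congrArg (cs.lift ⟨_, M.isLiftable_geomReflection⟩) h
  simpa using this

end CoxeterMatrix

theorem Function.End.mul_apply {α : Type*} (f g : Function.End α) (x : α) :
    (f * g) x = f (g x) := rfl

theorem Function.End.one_apply {α : Type*} (x : α) : (1 : Function.End α) x = x := rfl

/-! ### The exchange property and dihedral prefixes in Coxeter groups. -/

namespace CoxeterSystem

universe v

variable {B : Type v} {M : CoxeterMatrix B} {W : Type*} [Group W] (cs : CoxeterSystem M W)

/-- Conjugation by `s_j` inverts `s_i s_j`, so conjugating a dihedral reflection by a power of the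
rotation shifts its exponent by twice that power. -/
theorem simple_mul_pow_conj (i j : B) (k l : ℕ) :
    ((cs.simple i * cs.simple j) ^ k)⁻¹ * (cs.simple j * (cs.simple i * cs.simple j) ^ l) *
      (cs.simple i * cs.simple j) ^ k = cs.simple j * (cs.simple i * cs.simple j) ^ (2 * k + l) := by
  have h : SemiconjBy (cs.simple j) (cs.simple i * cs.simple j)
      (cs.simple i * cs.simple j)⁻¹ := by
    simp [SemiconjBy, mul_assoc]
  have hk := (h.pow_right k).eq
  rw [inv_pow] at hk
  rw [← mul_assoc, ← hk, mul_assoc, mul_assoc, ← pow_add, ← pow_add]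
  congr 2
  omega

open Classical in
/-- The action of a simple reflection on pairs of a group element `t` and a parity: it conjugates
`t`, and changes the parity when `t` is this simple reflection. -/
noncomputable def parityAct (i : B) : Function.End (W × ZMod 2) :=
  fun p => (cs.simple i * p.1 * cs.simple i, p.2 + if p.1 = cs.simple i then 1 else 0)

open Classical in
theorem parityAct_mul_pow_apply (i j : B) (k : ℕ) (t : W) (e : ZMod 2) :
    ((cs.parityAct i * cs.parityAct j) ^ k) (t, e) =
      ((cs.simple i * cs.simple j) ^ k * t * ((cs.simple i * cs.simple j) ^ k)⁻¹,
        e + ∑ l ∈ Finset.range (2 * k),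
          if t = cs.simple j * (cs.simple i * cs.simple j) ^ l then 1 else 0) := by
  induction k with
  | zero => simp [Function.End.one_apply]
  | succ k ih =>
    have h0 := cs.simple_mul_pow_conj i j k 0
    have h1 := cs.simple_mul_pow_conj i j k 1
    set p := cs.simple i * cs.simple j with hp
    rw [pow_succ', Function.End.mul_apply, ih, Function.End.mul_apply]
    simp only [parityAct, Prod.mk.injEq]
    refine ⟨?_, ?_⟩
    · rw [pow_succ']
      simp only [hp, mul_inv_rev, inv_simple, mul_assoc]
    · rw [show 2 * (k + 1) = 2 * k + 1 + 1 by ring, Finset.sum_range_succ, Finset.sum_range_succ,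
        add_assoc, add_assoc, add_assoc]
      congr 2
      have e0 : p ^ k * t * (p ^ k)⁻¹ = cs.simple j ↔ t = cs.simple j * p ^ (2 * k) := by
        rw [← add_zero (2 * k), ← h0, pow_zero, mul_one]
        constructor
        · intro h; rw [← h]; group
        · intro h; rw [h]; group
      have e1 : cs.simple j * (p ^ k * t * (p ^ k)⁻¹) * cs.simple j = cs.simple i ↔
          t = cs.simple j * p ^ (2 * k + 1) := by
        rw [← h1, pow_one, hp]
        generalize (cs.simple i * cs.simple j) ^ k = q
        constructor
        · intro h
          rw [← h]
          simp [mul_assoc]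
        · rintro rfl
          simp [mul_assoc]
      simp only [e0, e1]

/-- Since `(s_i s_j) ^ m = 1`, the `2m` reflections that can flip the parity form two copies of the
same list, so all flips cancel modulo `2`. -/
theorem isLiftable_parityAct : M.IsLiftable cs.parityAct := by
  classical
  intro i j
  funext ⟨t, e⟩
  rw [parityAct_mul_pow_apply, two_mul, Finset.sum_range_add]
  simp only [pow_add, simple_mul_simple_pow, one_mul, mul_one, inv_one]
  rw [CharTwo.add_self_eq_zero, add_zero]
  rfl

open Classical in
theorem lift_parityAct_wordProd (ω : List B) (t : W) (e : ZMod 2) :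
    cs.lift ⟨_, cs.isLiftable_parityAct⟩ (cs.wordProd ω) (t, e) =
      (cs.wordProd ω * t * (cs.wordProd ω)⁻¹, e + (cs.rightInvSeq ω).count t) := by
  induction ω with
  | nil => simp [Function.End.one_apply]
  | cons i ω ih =>
    rw [wordProd_cons, map_mul, Function.End.mul_apply, ih, lift_apply_simple]
    have h : cs.wordProd ω * t * (cs.wordProd ω)⁻¹ = cs.simple i ↔
        (cs.wordProd ω)⁻¹ * cs.simple i * cs.wordProd ω = t := by
      constructor
      · intro h; rw [← h]; group
      · intro h; rw [← h]; group
    simp only [parityAct, rightInvSeq, List.count_cons, mul_inv_rev, inv_simple, mul_assoc,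
      beq_iff_eq] at h ⊢
    rw [if_congr h rfl rfl]
    push_cast
    rw [add_assoc]

-- The action factors through the group, so the parity of the number of occurrences of a reflection
-- in the inversion sequence is an invariant of the group element. The exchange property rests on
-- this.
open Classical in
theorem count_rightInvSeq_congr {ω ω' : List B} (h : cs.wordProd ω = cs.wordProd ω') (t : W) :
    ((cs.rightInvSeq ω).count t : ZMod 2) = (cs.rightInvSeq ω').count t := by
  have h1 := cs.lift_parityAct_wordProd ω t 0
  rw [h, lift_parityAct_wordProd] at h1
  simpa using (congrArg Prod.snd h1).symm

theorem mem_rightInvSeq_of_nodup {ω ω' : List B} (h : cs.wordProd ω = cs.wordProd ω')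
    (hω : (cs.rightInvSeq ω).Nodup) {t : W} (ht : t ∈ cs.rightInvSeq ω) :
    t ∈ cs.rightInvSeq ω' := by
  classical
  have h1 := cs.count_rightInvSeq_congr h t
  rw [List.count_eq_one_of_mem hω ht] at h1
  by_contra hc
  rw [List.count_eq_zero_of_not_mem hc] at h1
  simp at h1

/-- Each entry occurs once, an odd number of times, hence also occurs in the inversion sequence of a
reduced word for the same element, which therefore cannot be shorter. -/
theorem isReduced_of_nodup_rightInvSeq {ω : List B} (hω : (cs.rightInvSeq ω).Nodup) :
    cs.IsReduced ω := by
  obtain ⟨ω', hr, h⟩ := cs.exists_isReduced (cs.wordProd ω)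
  apply le_antisymm (cs.length_wordProd_le ω)
  have := (List.subperm_of_subset hω fun t ht => cs.mem_rightInvSeq_of_nodup h hω ht).length_le
  rw [length_rightInvSeq, length_rightInvSeq] at this
  rwa [h, hr.eq]

/-- The exchange property, on the right. -/
theorem exchange_right (ω : List B) {i : B} (h : cs.IsRightDescent (cs.wordProd ω) i) :
    ∃ ω₁ k ω₂, ω = ω₁ ++ k :: ω₂ ∧ cs.wordProd ω * cs.simple i = cs.wordProd (ω₁ ++ ω₂) := by
  obtain ⟨ω', hr, h'⟩ := cs.exists_isReduced (cs.wordProd ω * cs.simple i)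
  -- A reduced word of the same element ending in `i` has `s_i` in its inversion sequence; parity
  -- forces `s_i` into the inversion sequence of `ω`, and its position is the letter to delete.
  have hp : cs.wordProd (ω'.concat i) = cs.wordProd ω := by
    rw [wordProd_concat, ← h', simple_mul_simple_cancel_right]
  have hr' : cs.IsReduced (ω'.concat i) := by
    rw [IsReduced, hp, List.length_concat, ← hr.eq, ← h']
    exact (cs.isRightDescent_iff.mp h).symm
  have hmem : cs.simple i ∈ cs.rightInvSeq ω := by
    apply cs.mem_rightInvSeq_of_nodup hp hr'.nodup_rightInvSeq
    rw [rightInvSeq_concat]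
    simp
  obtain ⟨n, hn, hni⟩ := List.mem_iff_getElem.mp hmem
  rw [← List.getD_eq_getElem _ 1 hn] at hni
  have hn' : n < ω.length := by simpa using hn
  refine ⟨ω.take n, ω[n], ω.drop (n + 1), by simp, ?_⟩
  rw [← hni, wordProd_mul_getD_rightInvSeq, List.eraseIdx_eq_take_drop_succ]

/-- The exchange property, on the left. -/
theorem exchange_left (ω : List B) {i : B} (h : cs.IsLeftDescent (cs.wordProd ω) i) :
    ∃ ω₁ k ω₂, ω = ω₁ ++ k :: ω₂ ∧ cs.simple i * cs.wordProd ω = cs.wordProd (ω₁ ++ ω₂) := by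
  have h' : cs.IsRightDescent (cs.wordProd ω.reverse) i := by
    rwa [wordProd_reverse, isRightDescent_inv_iff]
  obtain ⟨ω₁, k, ω₂, h1, h2⟩ := cs.exchange_right _ h'
  refine ⟨ω₂.reverse, k, ω₁.reverse, ?_, ?_⟩
  · rw [← List.reverse_reverse ω, h1]
    simp
  · have := congrArg (·⁻¹) h2
    simp only [mul_inv_rev, inv_simple] at this
    rw [← wordProd_reverse, ← wordProd_reverse, List.reverse_reverse] at this
    rw [this, List.reverse_append]

theorem rightInvSeq_alternatingWord (i j : B) (k : ℕ) :
    cs.rightInvSeq (alternatingWord i j k) =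
      ((List.range k).map fun l => cs.simple j * (cs.simple i * cs.simple j) ^ l).reverse := by
  induction k with
  | zero => simp [alternatingWord]
  | succ k ih =>
    rw [alternatingWord_succ', List.range_succ, List.map_append, List.reverse_append, ← ih]
    simp only [rightInvSeq, List.map_cons, List.map_nil, List.reverse_singleton,
      List.singleton_append, List.cons.injEq, and_true]
    rw [prod_alternatingWord_eq_mul_pow]
    obtain ⟨l, rfl | rfl⟩ := Nat.even_or_odd' k
    · have h := cs.simple_mul_pow_conj i j l 0
      rw [show 2 * l / 2 = l by omega, if_pos (by simp), if_pos (by simp)]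
      simpa [mul_assoc] using h
    · have h := cs.simple_mul_pow_conj i j l 1
      rw [show (2 * l + 1) / 2 = l by omega, if_neg (by simp), if_neg (by simp), ← h]
      simp [mul_assoc]

theorem isReduced_alternatingWord {i j : B} (hij : i ≠ j) {k : ℕ}
    (hk : M i j ≠ 0 → k ≤ M i j) : cs.IsReduced (alternatingWord i j k) := by
  apply cs.isReduced_of_nodup_rightInvSeq
  rw [rightInvSeq_alternatingWord, List.nodup_reverse]
  refine List.Nodup.map_on ?_ List.nodup_range
  have key : ∀ a b : ℕ, a < b → b < k →
      cs.simple j * (cs.simple i * cs.simple j) ^ a ≠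
        cs.simple j * (cs.simple i * cs.simple j) ^ b := by
    intro a b hab hb h
    apply cs.simple_mul_simple_pow_ne_one hij (k := b - a) (by omega)
      (fun h0 => by have := hk h0; omega)
    rw [mul_right_inj, show b = a + (b - a) by omega, pow_add] at h
    simpa using h
  intro a ha b hb h
  rw [List.mem_range] at ha hb
  by_contra hne
  rcases lt_or_gt_of_ne hne with hlt | hlt
  · exact key a b hlt hb h
  · exact key b a hlt ha h.symm

theorem reverse_alternatingWord (i j : B) (k : ℕ) :
    (alternatingWord i j k).reverse =
      if Even k then alternatingWord j i k else alternatingWord i j k := by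
  induction k generalizing i j with
  | zero => simp [alternatingWord]
  | succ k ih =>
    rw [alternatingWord_succ, List.concat_eq_append, List.reverse_append, ih,
      ← List.concat_eq_append, ← alternatingWord_succ, alternatingWord_succ' i j,
      alternatingWord_succ' j i]
    rcases Nat.even_or_odd k with h | h
    · simp [h, Nat.even_add_one]
    · simp [h, Nat.not_even_iff_odd.mpr h]

/-- An element with two left descents has long alternating prefixes. -/
theorem exists_eq_alternatingWord_mul {u : W} {i j : B} (hij : i ≠ j)
    (hi : cs.IsLeftDescent u i) (hj : cs.IsLeftDescent u j) (k : ℕ)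
    (hk : M i j ≠ 0 → k ≤ M i j) :
    ∃ u', u = cs.wordProd (alternatingWord i j k) * u' ∧ cs.length u = k + cs.length u' := by
  induction k with
  | zero => exact ⟨u, by simp [alternatingWord], by simp⟩
  | succ k ih =>
    obtain ⟨u', hu, hl⟩ := ih fun h0 => by have := hk h0; omega
    obtain ⟨ω, hω, rfl⟩ := cs.exists_isReduced u'
    rw [← wordProd_append] at hu
    rw [alternatingWord_succ']
    have hred := cs.isReduced_alternatingWord hij hk
    rw [alternatingWord_succ'] at hred
    have hq : cs.IsLeftDescent (cs.wordProd (alternatingWord i j k ++ ω))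
        (if Even k then j else i) := by
      rw [← hu]; split_ifs <;> assumption
    generalize (if Even k then j else i) = q at *
    obtain ⟨ω₁, c, ω₂, h1, h2⟩ := cs.exchange_left _ hq
    rw [← hu] at h2 hq
    have hd := cs.isLeftDescent_iff.mp hq
    -- If the deleted letter lies in `ω`, the alternating prefix grows by `q`. It cannot lie in the
    -- alternating prefix, because that prefix with `q` in front is still reduced (`hred`).
    rcases List.append_eq_append_iff.mp h1 with ⟨a, ha, hb⟩ | ⟨a, ha, hb⟩
    · refine ⟨cs.wordProd (a ++ ω₂), ?_, ?_⟩
      · rw [ha, List.append_assoc, wordProd_append] at h2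
        rw [wordProd_cons, mul_assoc, ← h2, simple_mul_simple_cancel_left]
      · have h3 := cs.length_wordProd_le (a ++ ω₂)
        have h4 : (a ++ ω₂).length + 1 = ω.length := by rw [hb]; simp; omega
        have h5 := cs.length_mul_le (cs.wordProd (alternatingWord i j k)) (cs.wordProd (a ++ ω₂))
        rw [← wordProd_append, ← List.append_assoc, ← ha, ← h2] at h5
        have h6 := cs.length_wordProd_le (alternatingWord i j k)
        rw [length_alternatingWord] at h6
        rw [hω.eq] at hl
        omega
    · cases a with
      | nil =>
        simp only [List.append_nil, List.nil_append] at ha hb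
        refine ⟨cs.wordProd ω₂, ?_, ?_⟩
        · rw [wordProd_append, ← ha] at h2
          rw [wordProd_cons, mul_assoc, ← h2, simple_mul_simple_cancel_left]
        · have h3 := cs.length_wordProd_le ω₂
          have h4 : ω₂.length + 1 = ω.length := by rw [← hb]; simp
          have h5 := cs.length_mul_le (cs.wordProd (alternatingWord i j k)) (cs.wordProd ω₂)
          rw [← wordProd_append, ha, ← h2] at h5
          have h6 := cs.length_wordProd_le (alternatingWord i j k)
          rw [length_alternatingWord] at h6
          rw [hω.eq] at hl
          rw [ha] at h6
          omega
      | cons c' a =>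
        simp only [List.cons_append, List.cons.injEq] at hb
        obtain ⟨rfl, rfl⟩ := hb
        exfalso
        rw [hu, ← List.append_assoc, wordProd_append, wordProd_append cs (ω₁ ++ a), ← mul_assoc,
          mul_left_inj, ← wordProd_cons] at h2
        have h3 := cs.length_wordProd_le (ω₁ ++ a)
        rw [← h2, hred.eq, ha] at h3
        simp at h3

/-- For the label `∞` there would be an alternating prefix longer than `u` itself. -/
theorem coxeterMatrix_ne_zero_of_isLeftDescent {u : W} {i j : B} (hij : i ≠ j)
    (hi : cs.IsLeftDescent u i) (hj : cs.IsLeftDescent u j) : M i j ≠ 0 := by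
  intro h0
  obtain ⟨u', -, h⟩ := cs.exists_eq_alternatingWord_mul hij hi hj (cs.length u + 1)
    fun h => absurd h0 h
  omega

theorem exists_eq_mul_alternatingWord {u : W} {i j : B} (hij : i ≠ j)
    (hi : cs.IsRightDescent u i) (hj : cs.IsRightDescent u j) (k : ℕ)
    (hk : M i j ≠ 0 → k ≤ M i j) :
    ∃ u', u = u' * cs.wordProd (alternatingWord i j k) ∧ cs.length u = cs.length u' + k := by
  have hi' : cs.IsLeftDescent u⁻¹ i := cs.isLeftDescent_inv_iff.mpr hi
  have hj' : cs.IsLeftDescent u⁻¹ j := cs.isLeftDescent_inv_iff.mpr hj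
  have : ∃ u', u⁻¹ = cs.wordProd (alternatingWord i j k).reverse * u' ∧
      cs.length u⁻¹ = k + cs.length u' := by
    rw [reverse_alternatingWord]
    split_ifs
    · exact cs.exists_eq_alternatingWord_mul hij.symm hj' hi' k (by rwa [M.symmetric])
    · exact cs.exists_eq_alternatingWord_mul hij hi' hj' k hk
  obtain ⟨u', h1, h2⟩ := this
  refine ⟨u'⁻¹, ?_, ?_⟩
  · rw [← inv_inv u, h1, wordProd_reverse, mul_inv_rev, inv_inv]
  · rw [length_inv] at h2 ⊢
    omega

/-- Here `y` is minimal in its coset of the dihedral subgroup. If the last letter lowered the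
length, the product before it would have both right descents and so end in an alternating word one
letter longer than the one appended to `y`; cancelling would exhibit a right descent of `y`. -/
theorem length_mul_alternatingWord {y : W} {i j : B} (hij : i ≠ j)
    (hi : ¬ cs.IsRightDescent y i) (hj : ¬ cs.IsRightDescent y j) (k : ℕ)
    (hk : M i j ≠ 0 → k ≤ M i j) :
    cs.length (y * cs.wordProd (alternatingWord i j k)) = cs.length y + k := by
  induction k generalizing i j with
  | zero => simp [alternatingWord]
  | succ k ih =>
    have hk' : M j i ≠ 0 → k + 1 ≤ M j i := by rwa [M.symmetric]
    have ih1 := ih hij.symm hj hi fun h0 => by have := hk' h0; omega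
    rw [alternatingWord_succ, wordProd_concat, ← mul_assoc]
    set x := y * cs.wordProd (alternatingWord j i k) with hx
    rcases cs.length_mul_simple x j with h | h
    · rw [h, ih1, add_assoc]
    exfalso
    have hxj : cs.IsRightDescent x j := cs.isRightDescent_iff.mpr h
    cases k with
    | zero =>
      apply hj
      simpa [hx, alternatingWord] using hxj
    | succ k =>
      have hxi : cs.IsRightDescent x i := by
        rw [IsRightDescent, hx, alternatingWord_succ, wordProd_concat, ← mul_assoc,
          simple_mul_simple_cancel_right, mul_assoc, ← wordProd_concat, ← alternatingWord_succ,
          ← hx, ih1]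
        have h1 := cs.length_mul_le y (cs.wordProd (alternatingWord i j k))
        have h2 := cs.length_wordProd_le (alternatingWord i j k)
        rw [length_alternatingWord] at h2
        omega
      obtain ⟨u', h1, h2⟩ := cs.exists_eq_mul_alternatingWord hij.symm hxj hxi (k + 1 + 1) hk'
      rw [alternatingWord_succ', wordProd_cons, ← mul_assoc, hx, mul_left_inj] at h1
      have hq : ¬ cs.IsRightDescent y (if Even (k + 1) then i else j) := by
        split_ifs <;> assumption
      apply hq
      rw [IsRightDescent]
      nth_rw 1 [h1]
      rw [simple_mul_simple_cancel_right]
      omega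

end CoxeterSystem

theorem CoxeterSystem.mem_alternatingWord {B : Type*} {i j : B} {m : ℕ} (hm : 2 ≤ m) (x : B) :
    x ∈ alternatingWord i j m ↔ x = i ∨ x = j := by
  obtain ⟨k, rfl⟩ := Nat.exists_eq_add_of_le' hm
  rw [alternatingWord_succ, alternatingWord_succ]
  simp only [List.concat_eq_append, List.mem_append, List.mem_singleton]
  refine ⟨?_, by tauto⟩
  rintro ((h | h) | h)
  · have : ∀ (n : ℕ) (i j : B), x ∈ alternatingWord i j n → x = i ∨ x = j := by
      intro n
      induction n with
      | zero => simp [alternatingWord]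
      | succ n ih =>
        intro i j h
        rw [alternatingWord_succ, List.concat_eq_append, List.mem_append,
          List.mem_singleton] at h
        rcases h with h | h
        · exact (ih _ _ h).symm
        · exact Or.inr h
    exact this _ _ _ h
  · exact Or.inl h
  · exact Or.inr h

theorem CoxeterMatrix.two_le_of_ne {B : Type*} (M : CoxeterMatrix B) {i j : B} (hij : i ≠ j)
    (h0 : M i j ≠ 0) : 2 ≤ M i j := by
  have := M.off_diagonal i j hij
  omega

namespace ArtinTitsMonoid

open CoxeterSystem

variable {B : Type u} {M : CoxeterMatrix B}

/-! ### Words, length, support and projection to the Coxeter group -/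

/-- The generator with a given label. -/
def gen (M : CoxeterMatrix B) (i : B) : ArtinTitsMonoid M := PresentedMonoid.of _ i

/-- The element represented by a word. -/
def mkWord (M : CoxeterMatrix B) (ω : List B) : ArtinTitsMonoid M :=
  PresentedMonoid.mk _ (FreeMonoid.ofList ω)

@[simp] theorem mkWord_nil : mkWord M [] = 1 := rfl

theorem mkWord_append (ω ω' : List B) : mkWord M (ω ++ ω') = mkWord M ω * mkWord M ω' :=
  map_mul (PresentedMonoid.mk (ArtinTitsRel M)) _ _

theorem mkWord_cons (i : B) (ω : List B) : mkWord M (i :: ω) = gen M i * mkWord M ω :=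
  mkWord_append [i] ω

theorem mkWord_singleton (i : B) : mkWord M [i] = gen M i := rfl

theorem mkWord_surjective : Function.Surjective (mkWord M) := fun x =>
  (PresentedMonoid.surjective_mk x).imp fun _ h => h

theorem mkWord_braid {i j : B} (hij : i ≠ j) (h0 : M i j ≠ 0) :
    mkWord M (alternatingWord i j (M i j)) = mkWord M (alternatingWord j i (M i j)) :=
  PresentedMonoid.mk_eq_mk_of_rel (ArtinTitsRel.braid i j hij h0)

/-- The universal property of the Artin–Tits monoid. -/
def liftHom {N : Type*} [Monoid N] (f : B → N)
    (h : ∀ i j, i ≠ j → M i j ≠ 0 → ((alternatingWord i j (M i j)).map f).prod =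
      ((alternatingWord j i (M i j)).map f).prod) : ArtinTitsMonoid M →* N :=
  PresentedMonoid.lift f (by
    rintro _ _ ⟨i, j, hij, h0⟩
    simpa [FreeMonoid.lift_apply] using h i j hij h0)

theorem liftHom_mkWord {N : Type*} [Monoid N] (f : B → N)
    (h : ∀ i j, i ≠ j → M i j ≠ 0 → ((alternatingWord i j (M i j)).map f).prod =
      ((alternatingWord j i (M i j)).map f).prod) (ω : List B) :
    liftHom f h (mkWord M ω) = (ω.map f).prod :=
  (FreeMonoid.lift_apply f (FreeMonoid.ofList ω)).trans (by rw [FreeMonoid.toList_ofList])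

/-- The canonical projection to the Coxeter group. -/
def proj (M : CoxeterMatrix B) : ArtinTitsMonoid M →* M.Group :=
  liftHom M.toCoxeterSystem.simple fun i j _ _ => by
    have := M.toCoxeterSystem.wordProd_braidWord_eq i j
    simp only [braidWord, M.symmetric j i] at this
    exact this

theorem proj_mkWord (ω : List B) : proj M (mkWord M ω) = M.toCoxeterSystem.wordProd ω :=
  liftHom_mkWord _ _ ω

theorem proj_gen (i : B) : proj M (gen M i) = M.toCoxeterSystem.simple i := by
  rw [← mkWord_singleton, proj_mkWord, wordProd_singleton]

/-- The length homomorphism. -/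
def lenHom (M : CoxeterMatrix B) : ArtinTitsMonoid M →* Multiplicative ℕ :=
  liftHom (fun _ => Multiplicative.ofAdd 1) fun i j _ _ => by simp

/-- The length of an element. -/
def len (x : ArtinTitsMonoid M) : ℕ := (lenHom M x).toAdd

theorem len_mul (x y : ArtinTitsMonoid M) : len (x * y) = len x + len y := by
  simp [len]

@[simp] theorem len_one : len (1 : ArtinTitsMonoid M) = 0 := by simp [len]

theorem len_mkWord (ω : List B) : len (mkWord M ω) = ω.length := by
  simp [len, lenHom, liftHom_mkWord]

@[simp] theorem len_gen (i : B) : len (gen M i) = 1 := len_mkWord [i]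

theorem eq_one_of_len_eq_zero {x : ArtinTitsMonoid M} (h : len x = 0) : x = 1 := by
  obtain ⟨ω, rfl⟩ := mkWord_surjective x
  rw [len_mkWord, List.length_eq_zero_iff] at h
  rw [h, mkWord_nil]

theorem gen_ne_one (i : B) : gen M i ≠ 1 := fun h => by
  have := congrArg len h
  simp at this

theorem length_proj_le (x : ArtinTitsMonoid M) : M.toCoxeterSystem.length (proj M x) ≤ len x := by
  obtain ⟨ω, rfl⟩ := mkWord_surjective x
  rw [len_mkWord, proj_mkWord]
  exact length_wordProd_le _ _

theorem exists_eq_gen_mul {x : ArtinTitsMonoid M} (h : x ≠ 1) : ∃ i y, x = gen M i * y := by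
  obtain ⟨ω, rfl⟩ := mkWord_surjective x
  cases ω with
  | nil => exact absurd rfl h
  | cons i ω => exact ⟨i, _, mkWord_cons i ω⟩

theorem exists_eq_mul_gen {x : ArtinTitsMonoid M} (h : x ≠ 1) : ∃ i y, x = y * gen M i := by
  obtain ⟨ω, rfl⟩ := mkWord_surjective x
  rcases List.eq_nil_or_concat ω with rfl | ⟨ω', i, rfl⟩
  · exact absurd rfl h
  · exact ⟨i, _, by rw [List.concat_eq_append, mkWord_append, mkWord_singleton]⟩

theorem exists_gen_dvd {x : ArtinTitsMonoid M} (h : x ≠ 1) : ∃ i, gen M i ∣ x :=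
  (exists_eq_gen_mul h).imp fun _ ⟨y, hy⟩ => ⟨y, hy⟩

open Classical in
/-- The homomorphism to `ℕ` sending `b` to `0` and the other generators to `1`. -/
noncomputable def avoidHom (M : CoxeterMatrix B) (b : B) : ArtinTitsMonoid M →* ℕ :=
  liftHom (fun i => if i = b then 0 else 1) fun i j hij h0 => by
    have key : ∀ ω : List B, (ω.map fun i => if i = b then 0 else 1).prod =
        if b ∈ ω then 0 else 1 := by
      intro ω
      induction ω with
      | nil => simp
      | cons a ω ih =>
        rw [List.map_cons, List.prod_cons, ih]
        by_cases h : a = b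
        · simp [h]
        · simp [h, Ne.symm h]
    rw [key, key]
    simp only [mem_alternatingWord (M.two_le_of_ne hij h0), or_comm]

/-- The set of letters occurring in an element. -/
def supp (x : ArtinTitsMonoid M) : Set B := {b | avoidHom M b x = 0}

theorem mem_supp_mkWord {b : B} {ω : List B} : b ∈ supp (mkWord M ω) ↔ b ∈ ω := by
  rw [supp, Set.mem_ofPred_eq, avoidHom, liftHom_mkWord, List.prod_eq_zero_iff, List.mem_map]
  simp

@[simp] theorem supp_one : supp (1 : ArtinTitsMonoid M) = ∅ := by
  ext b
  simp [supp]

theorem supp_mul (x y : ArtinTitsMonoid M) : supp (x * y) = supp x ∪ supp y := by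
  ext b
  simp [supp]

@[simp] theorem supp_gen (i : B) : supp (gen M i) = {i} := by
  ext b
  rw [← mkWord_singleton, mem_supp_mkWord]
  simp

theorem supp_subset_of_dvd {x y : ArtinTitsMonoid M} (h : x ∣ y) : supp x ⊆ supp y := by
  obtain ⟨z, rfl⟩ := h
  rw [supp_mul]
  exact Set.subset_union_left

theorem gen_injective : Function.Injective (gen M) := fun i j h => by
  have := congrArg supp h
  simpa using this

theorem exists_eq_gen_of_len_eq_one {x : ArtinTitsMonoid M} (h : len x = 1) :
    ∃ i, x = gen M i := by
  obtain ⟨ω, rfl⟩ := mkWord_surjective x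
  rw [len_mkWord, List.length_eq_one_iff] at h
  obtain ⟨i, rfl⟩ := h
  exact ⟨i, rfl⟩

/-- The word property: two reduced words of the same element of the Coxeter group represent the
same element of the Artin–Tits monoid. -/
theorem mkWord_eq_of_isReduced {ω ω' : List B} (hω : M.toCoxeterSystem.IsReduced ω)
    (hω' : M.toCoxeterSystem.IsReduced ω')
    (h : M.toCoxeterSystem.wordProd ω = M.toCoxeterSystem.wordProd ω') :
    mkWord M ω = mkWord M ω' := by
  induction hn : ω.length using Nat.strong_induction_on generalizing ω ω' with
  | _ n ih =>
  subst hn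
  set cs := M.toCoxeterSystem with hcs
  have hlen : ω.length = ω'.length := by rw [← hω.eq, h, hω'.eq]
  rcases ω with _ | ⟨i, ω⟩
  · rw [List.length_nil] at hlen
    rw [List.length_eq_zero_iff.mp hlen.symm]
  rcases ω' with _ | ⟨j, ω'⟩
  · simp at hlen
  have r : cs.IsReduced ω := by simpa using hω.drop 1
  have r' : cs.IsReduced ω' := by simpa using hω'.drop 1
  have hω1 := hω.eq
  have hω1' := hω'.eq
  have hr1 := r.eq
  have hr1' := r'.eq
  by_cases hij : i = j
  · subst hij
    rw [wordProd_cons, wordProd_cons, mul_right_inj] at h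
    rw [mkWord_cons, mkWord_cons, ih _ (by simp) r r' h rfl]
  have di : cs.IsLeftDescent (cs.wordProd (i :: ω)) i := by
    rw [IsLeftDescent, hω1, wordProd_cons, simple_mul_simple_cancel_left, hr1]
    simp
  have dj : cs.IsLeftDescent (cs.wordProd (i :: ω)) j := by
    rw [h, IsLeftDescent, hω1', wordProd_cons, simple_mul_simple_cancel_left, hr1']
    simp
  have h0 := cs.coxeterMatrix_ne_zero_of_isLeftDescent hij di dj
  -- A reduced word starting with `a` may be replaced by a braid word followed by `ν`: write the
  -- braid word with `a` in front and apply the induction hypothesis to the tails. Used once for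
  -- each first letter, this leaves two braid words that agree by a defining relation.
  have key : ∀ (a b : B) (ν : List B), a ≠ b → M a b ≠ 0 → cs.IsLeftDescent (cs.wordProd (i :: ω)) a →
      cs.IsLeftDescent (cs.wordProd (i :: ω)) b → cs.IsReduced ν → ∀ ρ, cs.IsReduced (a :: ρ) →
      cs.wordProd (a :: ρ) = cs.wordProd (i :: ω) →
      cs.wordProd (i :: ω) = cs.wordProd (alternatingWord a b (M a b)) * cs.wordProd ν →
      cs.length (cs.wordProd (i :: ω)) = M a b + ν.length →
      mkWord M (a :: ρ) = mkWord M (alternatingWord a b (M a b)) * mkWord M ν := by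
    intro a b ν hab hm ha hb hν ρ hρ hρω hd hl
    have two := M.two_le_of_ne hab hm
    obtain ⟨e, he⟩ : ∃ e, mkWord M (alternatingWord a b (M a b)) = mkWord M (a :: e) ∧
        cs.wordProd (alternatingWord a b (M a b)) = cs.wordProd (a :: e) ∧
        e.length + 1 = M a b := by
      obtain ⟨k, hk⟩ := Nat.exists_eq_add_of_le' (show 1 ≤ M a b by omega)
      rcases Nat.even_or_odd k with hk' | hk'
      · refine ⟨alternatingWord b a k, ?_, ?_, by simp [hk]⟩
        · rw [mkWord_braid hab hm, hk, alternatingWord_succ', if_pos hk']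
        · have := cs.wordProd_braidWord_eq a b
          rw [braidWord, braidWord, M.symmetric b a] at this
          rw [this, hk, alternatingWord_succ', if_pos hk']
      · refine ⟨alternatingWord a b k, ?_, ?_, by simp [hk]⟩
        · rw [hk, alternatingWord_succ', if_neg (Nat.not_even_iff_odd.mpr hk')]
        · rw [hk, alternatingWord_succ', if_neg (Nat.not_even_iff_odd.mpr hk')]
    obtain ⟨he1, he2, he3⟩ := he
    have hρl : (a :: ρ).length = (i :: ω).length := by rw [← hρ.eq, hρω, hω.eq]
    have rρ : cs.IsReduced ρ := by simpa using hρ.drop 1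
    have hp : cs.wordProd ρ = cs.wordProd (e ++ ν) := by
      rw [hd, he2, wordProd_cons, wordProd_cons, mul_assoc, mul_right_inj] at hρω
      rw [hρω, wordProd_append]
    have reν : cs.IsReduced (e ++ ν) := by
      rw [CoxeterSystem.IsReduced, ← hp, rρ.eq, List.length_append]
      rw [hω1, ← hρl, List.length_cons] at hl
      omega
    rw [he1, mkWord_cons, mkWord_cons, mul_assoc, ← mkWord_append,
      ih ρ.length (by simp only [List.length_cons] at hρl ⊢; omega) rρ reν hp rfl]
  obtain ⟨v, hv, hl⟩ := cs.exists_eq_alternatingWord_mul hij di dj (M i j) fun _ => le_rfl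
  obtain ⟨ν, hν, rfl⟩ := cs.exists_isReduced v
  rw [hν.eq] at hl
  have hb := cs.wordProd_braidWord_eq i j
  rw [braidWord, braidWord, M.symmetric j i] at hb
  rw [key i j ν hij h0 di dj hν ω hω rfl hv hl,
    key j i ν (Ne.symm hij) (by rwa [M.symmetric]) dj di hν ω' hω' h.symm
      (by rw [hv, hb, M.symmetric j i]) (by rw [hl, M.symmetric]),
    mkWord_braid hij h0, M.symmetric j i]

/-- The lift of an element of the Coxeter group, represented by any of its reduced words. -/
noncomputable def redLift (w : M.Group) : ArtinTitsMonoid M :=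
  mkWord M (M.toCoxeterSystem.exists_isReduced w).choose

theorem redLift_wordProd {ω : List B} (hω : M.toCoxeterSystem.IsReduced ω) :
    redLift (M.toCoxeterSystem.wordProd ω) = mkWord M ω := by
  have h := (M.toCoxeterSystem.exists_isReduced (M.toCoxeterSystem.wordProd ω)).choose_spec
  exact mkWord_eq_of_isReduced h.1 hω h.2.symm

@[simp] theorem proj_redLift (w : M.Group) : proj M (redLift w) = w := by
  obtain ⟨ω, hω, rfl⟩ := M.toCoxeterSystem.exists_isReduced w
  rw [redLift_wordProd hω, proj_mkWord]

@[simp] theorem len_redLift (w : M.Group) : len (redLift w) = M.toCoxeterSystem.length w := by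
  obtain ⟨ω, hω, rfl⟩ := M.toCoxeterSystem.exists_isReduced w
  rw [redLift_wordProd hω, len_mkWord, hω.eq]

theorem redLift_mul {v w : M.Group} (h : M.toCoxeterSystem.length (v * w) =
    M.toCoxeterSystem.length v + M.toCoxeterSystem.length w) :
    redLift (v * w) = redLift v * redLift w := by
  obtain ⟨ω, hω, rfl⟩ := M.toCoxeterSystem.exists_isReduced v
  obtain ⟨ω', hω', rfl⟩ := M.toCoxeterSystem.exists_isReduced w
  rw [redLift_wordProd hω, redLift_wordProd hω', ← wordProd_append, redLift_wordProd,
    mkWord_append]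
  rw [CoxeterSystem.IsReduced, wordProd_append, h, hω.eq, hω'.eq, List.length_append]

@[simp] theorem redLift_one : redLift (1 : M.Group) = 1 :=
  redLift_wordProd (ω := []) (by simp [CoxeterSystem.IsReduced])

@[simp] theorem redLift_simple (i : B) : redLift (M.toCoxeterSystem.simple i) = gen M i := by
  rw [← wordProd_singleton, redLift_wordProd, mkWord_singleton]
  rw [CoxeterSystem.IsReduced, wordProd_singleton, length_simple, List.length_singleton]

/-- The reduced elements of the Artin–Tits monoid, whose length is that of their projection to
the Coxeter group. -/
def IsRed (x : ArtinTitsMonoid M) : Prop := M.toCoxeterSystem.length (proj M x) = len x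

theorem isRed_redLift (w : M.Group) : IsRed (redLift w) := by simp [IsRed]

theorem isRed_mkWord {ω : List B} : IsRed (mkWord M ω) ↔ M.toCoxeterSystem.IsReduced ω := by
  rw [IsRed, proj_mkWord, len_mkWord, CoxeterSystem.IsReduced]

theorem IsRed.redLift_proj {x : ArtinTitsMonoid M} (h : IsRed x) : redLift (proj M x) = x := by
  obtain ⟨ω, rfl⟩ := mkWord_surjective x
  rw [proj_mkWord, redLift_wordProd (isRed_mkWord.mp h)]

theorem IsRed.of_mul {x y : ArtinTitsMonoid M} (h : IsRed (x * y)) : IsRed x ∧ IsRed y := by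
  have h1 := length_proj_le x
  have h2 := length_proj_le y
  have h3 := M.toCoxeterSystem.length_mul_le (proj M x) (proj M y)
  rw [IsRed, map_mul, len_mul] at h
  constructor
  · rw [IsRed]; omega
  · rw [IsRed]; omega

theorem isRed_gen (i : B) : IsRed (gen M i) := by
  rw [IsRed, proj_gen, length_simple, len_gen]

theorem not_isRed_mul_gen_mul_gen_mul (x y : ArtinTitsMonoid M) (i : B) :
    ¬ IsRed (x * gen M i * (gen M i * y)) := by
  intro h
  have h1 := M.toCoxeterSystem.length_mul_le (proj M x) (proj M y)
  have h2 := length_proj_le x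
  have h3 := length_proj_le y
  simp only [IsRed, map_mul, len_mul, proj_gen, mul_assoc, simple_mul_simple_cancel_left,
    len_gen] at h
  omega

end ArtinTitsMonoid

/-! ### The weak order, and the greatest prefix that a left factor absorbs. -/

namespace CoxeterSystem

section WeakOrder

variable {B W : Type*} {M : CoxeterMatrix B} [Group W] (cs : CoxeterSystem M W)

theorem isLeftDescent_braidWord_left {i j : B} (hij : i ≠ j) (h0 : M i j ≠ 0) :
    cs.IsLeftDescent (cs.wordProd (alternatingWord i j (M i j))) i := by
  have hred := cs.isReduced_alternatingWord hij (k := M i j) fun _ => le_rfl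
  have hb := cs.wordProd_braidWord_eq i j
  rw [braidWord, braidWord, M.symmetric j i] at hb
  rw [IsLeftDescent, hred.eq, length_alternatingWord]
  obtain ⟨k, hk⟩ := Nat.exists_eq_add_of_le' (show 1 ≤ M i j by omega)
  have : ∃ ω : List B, ω.length = k ∧
      cs.wordProd (alternatingWord i j (M i j)) = cs.wordProd (i :: ω) := by
    rcases Nat.even_or_odd k with hk' | hk'
    · exact ⟨alternatingWord j i k, by simp, by rw [hb, hk, alternatingWord_succ', if_pos hk']⟩
    · exact ⟨alternatingWord i j k, by simp, by
        rw [hk, alternatingWord_succ', if_neg (Nat.not_even_iff_odd.mpr hk')]⟩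
  obtain ⟨ω, hω, h⟩ := this
  rw [h, wordProd_cons, simple_mul_simple_cancel_left]
  have := cs.length_wordProd_le ω
  omega

theorem isLeftDescent_braidWord_right {i j : B} (hij : i ≠ j) (h0 : M i j ≠ 0) :
    cs.IsLeftDescent (cs.wordProd (alternatingWord i j (M i j))) j := by
  have hb := cs.wordProd_braidWord_eq i j
  rw [braidWord, braidWord] at hb
  rw [hb]
  exact cs.isLeftDescent_braidWord_left hij.symm (by rwa [M.symmetric])

/-- The right weak order: `v` is the beginning of a reduced decomposition of `w`. -/
def Prefix (v w : W) : Prop := cs.length w = cs.length v + cs.length (v⁻¹ * w)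

variable {cs}

theorem Prefix.refl (w : W) : cs.Prefix w w := by simp [Prefix]

theorem Prefix.trans {u v w : W} (h : cs.Prefix u v) (h' : cs.Prefix v w) : cs.Prefix u w := by
  have h1 := cs.length_mul_le (u⁻¹ * v) (v⁻¹ * w)
  have h2 := cs.length_mul_le u (u⁻¹ * w)
  rw [mul_inv_cancel_left] at h2
  rw [mul_assoc, mul_inv_cancel_left] at h1
  rw [Prefix] at *
  omega

theorem Prefix.length_inv_mul_add {u v w : W} (h : cs.Prefix u v) (h' : cs.Prefix v w) :
    cs.length (u⁻¹ * w) = cs.length (u⁻¹ * v) + cs.length (v⁻¹ * w) := by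
  have := h.trans h'
  rw [Prefix] at *
  omega

theorem Prefix.eq_of_length_le {v w : W} (h : cs.Prefix v w) (hl : cs.length w ≤ cs.length v) :
    v = w := by
  have : cs.length (v⁻¹ * w) = 0 := by rw [Prefix] at h; omega
  rw [length_eq_zero_iff, inv_mul_eq_one] at this
  exact this

theorem Prefix.mul_of_length_mul {v w : W}
    (h : cs.length (v * w) = cs.length v + cs.length w) : cs.Prefix v (v * w) := by
  rw [Prefix, inv_mul_cancel_left, h]

theorem Prefix.exists_simple {v w : W} (h : cs.Prefix v w) (hne : v ≠ w) :
    ∃ i, cs.length (v * cs.simple i) = cs.length v + 1 ∧ cs.Prefix (v * cs.simple i) w := by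
  obtain ⟨i, hi⟩ := cs.exists_leftDescent_of_ne_one (w := v⁻¹ * w) (by rwa [Ne, inv_mul_eq_one])
  rw [isLeftDescent_iff] at hi
  have h1 := cs.length_mul_le (v * cs.simple i) (cs.simple i * (v⁻¹ * w))
  have h2 : v * cs.simple i * (cs.simple i * (v⁻¹ * w)) = w := by
    rw [mul_assoc, simple_mul_simple_cancel_left, mul_inv_cancel_left]
  rw [h2] at h1
  rw [Prefix] at h
  have h3 := cs.length_mul_simple v i
  have h4 : cs.length (v * cs.simple i) = cs.length v + 1 := by omega
  refine ⟨i, h4, ?_⟩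
  rw [Prefix, mul_inv_rev, inv_simple, mul_assoc]
  omega

variable (cs)

/-- `v` is a prefix of `w` such that lengths add up in the product `x * v`. -/
def IsAbsorbed (x w v : W) : Prop :=
  cs.Prefix v w ∧ cs.length (x * v) = cs.length x + cs.length v

variable {cs}

theorem IsAbsorbed.of_prefix {x w u v : W} (hv : cs.IsAbsorbed x w v) (h : cs.Prefix u v) :
    cs.IsAbsorbed x w u := by
  refine ⟨h.trans hv.1, ?_⟩
  have h1 := cs.length_mul_le (x * u) (u⁻¹ * v)
  rw [mul_assoc, mul_inv_cancel_left, hv.2] at h1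
  have h2 := cs.length_mul_le x u
  rw [Prefix] at h
  omega

/-- Take `v` times the braid word. Both letters are left descents of `v⁻¹ * w`, so the braid word is
a prefix of it; neither is a right descent of `x * v`, so lengths still add there. -/
theorem IsAbsorbed.join {x w v : W} {i j : B} (hij : i ≠ j)
    (hi : cs.IsAbsorbed x w (v * cs.simple i)) (hj : cs.IsAbsorbed x w (v * cs.simple j))
    (hli : cs.length (v * cs.simple i) = cs.length v + 1)
    (hlj : cs.length (v * cs.simple j) = cs.length v + 1) :
    ∃ d, cs.IsAbsorbed x w d ∧ cs.Prefix (v * cs.simple i) d ∧ cs.Prefix (v * cs.simple j) d := by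
  have pv : ∀ k, cs.length (v * cs.simple k) = cs.length v + 1 →
      cs.Prefix v (v * cs.simple k) := fun k hk => by simp [Prefix, hk]
  have hv : cs.IsAbsorbed x w v := hi.of_prefix (pv i hli)
  have hw := hv.1
  have hdesc : ∀ k, cs.length (v * cs.simple k) = cs.length v + 1 →
      cs.IsAbsorbed x w (v * cs.simple k) → cs.IsLeftDescent (v⁻¹ * w) k := by
    intro k hk h
    have := h.1
    rw [Prefix, mul_inv_rev, inv_simple, mul_assoc] at this
    rw [Prefix] at hw
    rw [IsLeftDescent]
    omega
  have hnr : ∀ k, cs.length (v * cs.simple k) = cs.length v + 1 →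
      cs.IsAbsorbed x w (v * cs.simple k) → ¬ cs.IsRightDescent (x * v) k := by
    intro k hk h
    have h1 := h.2
    have h2 := hv.2
    rw [IsRightDescent, mul_assoc]
    omega
  have h0 := cs.coxeterMatrix_ne_zero_of_isLeftDescent hij (hdesc i hli hi) (hdesc j hlj hj)
  obtain ⟨u', hu, hl⟩ := cs.exists_eq_alternatingWord_mul hij (hdesc i hli hi) (hdesc j hlj hj)
    (M i j) fun _ => le_rfl
  have hx := cs.length_mul_alternatingWord hij (hnr i hli hi) (hnr j hlj hj) (M i j)
    fun _ => le_rfl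
  have hvi : ¬ cs.IsRightDescent v i := by rw [IsRightDescent]; omega
  have hvj : ¬ cs.IsRightDescent v j := by rw [IsRightDescent]; omega
  have hvd := cs.length_mul_alternatingWord hij hvi hvj (M i j) fun _ => le_rfl
  have hdi := cs.isLeftDescent_iff.mp (cs.isLeftDescent_braidWord_left hij h0)
  have hdj := cs.isLeftDescent_iff.mp (cs.isLeftDescent_braidWord_right hij h0)
  have hd : cs.length (cs.wordProd (alternatingWord i j (M i j))) = M i j := by
    rw [(cs.isReduced_alternatingWord hij fun _ => le_rfl).eq, length_alternatingWord]
  generalize cs.wordProd (alternatingWord i j (M i j)) = d at *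
  refine ⟨v * d, ⟨?_, ?_⟩, ?_, ?_⟩
  · rw [Prefix, mul_inv_rev, mul_assoc, hu, inv_mul_cancel_left]
    rw [Prefix] at hw
    omega
  · rw [← mul_assoc, hx, hv.2]
    omega
  · rw [Prefix, mul_inv_rev, inv_simple, mul_assoc, inv_mul_cancel_left]
    omega
  · rw [Prefix, mul_inv_rev, inv_simple, mul_assoc, inv_mul_cancel_left]
    omega

/-- Newman's argument: lengths are bounded by that of `w`, and `IsAbsorbed.join` is local
confluence. -/
theorem IsAbsorbed.exists_greatest_above {x w v : W} (hv : cs.IsAbsorbed x w v) :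
    ∃ m, cs.IsAbsorbed x w m ∧ cs.Prefix v m ∧
      ∀ v', cs.IsAbsorbed x w v' → cs.Prefix v v' → cs.Prefix v' m := by
  induction hn : cs.length w - cs.length v using Nat.strong_induction_on generalizing v with
  | _ n ih =>
  subst hn
  have step : ∀ k, cs.length (v * cs.simple k) = cs.length v + 1 →
      cs.IsAbsorbed x w (v * cs.simple k) → ∃ m, cs.IsAbsorbed x w m ∧
        cs.Prefix (v * cs.simple k) m ∧
        ∀ v', cs.IsAbsorbed x w v' → cs.Prefix (v * cs.simple k) v' → cs.Prefix v' m := by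
    intro k hk h
    refine ih _ ?_ h rfl
    have := h.1
    rw [Prefix] at this
    omega
  by_cases hs : ∃ i, cs.length (v * cs.simple i) = cs.length v + 1 ∧
      cs.IsAbsorbed x w (v * cs.simple i)
  · obtain ⟨i, hli, hi⟩ := hs
    obtain ⟨m, hm, him, hmax⟩ := step i hli hi
    have pv : cs.Prefix v (v * cs.simple i) := by simp [Prefix, hli]
    refine ⟨m, hm, pv.trans him, fun v' hv' hvv' => ?_⟩
    by_cases hne : v = v'
    · rw [← hne]
      exact pv.trans him
    obtain ⟨j, hlj, hj⟩ := hvv'.exists_simple hne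
    by_cases hij : i = j
    · rw [← hij] at hj
      exact hmax v' hv' hj
    have hja := hv'.of_prefix hj
    obtain ⟨d, hd, hid, hjd⟩ := hi.join hij hja hli hlj
    obtain ⟨m', hm', hjm', hmax'⟩ := step j hlj hja
    exact (hmax' v' hv' hj).trans (hmax m' hm' (hid.trans (hmax' d hd hjd)))
  · refine ⟨v, hv, Prefix.refl v, fun v' hv' hvv' => ?_⟩
    by_contra hc
    obtain ⟨j, hlj, hj⟩ := hvv'.exists_simple fun h => hc (h ▸ Prefix.refl v)
    exact hs ⟨j, hlj, hv'.of_prefix hj⟩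

variable (cs)

theorem exists_greatest_isAbsorbed (x w : W) :
    ∃ m, cs.IsAbsorbed x w m ∧ ∀ v, cs.IsAbsorbed x w v → cs.Prefix v m := by
  have h1 : cs.IsAbsorbed x w 1 := by simp [IsAbsorbed, Prefix]
  obtain ⟨m, hm, -, h⟩ := h1.exists_greatest_above
  exact ⟨m, hm, fun v hv => h v hv (by simp [Prefix])⟩

/-- The greatest prefix `v` of `w` such that lengths add up in the product `x * v`. -/
noncomputable def absorbed (x w : W) : W := (cs.exists_greatest_isAbsorbed x w).choose

theorem isAbsorbed_absorbed (x w : W) : cs.IsAbsorbed x w (cs.absorbed x w) :=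
  (cs.exists_greatest_isAbsorbed x w).choose_spec.1

theorem prefix_absorbed {x w v : W} (h : cs.IsAbsorbed x w v) : cs.Prefix v (cs.absorbed x w) :=
  (cs.exists_greatest_isAbsorbed x w).choose_spec.2 v h

theorem absorbed_one (w : W) : cs.absorbed 1 w = w :=
  (cs.isAbsorbed_absorbed 1 w).1.eq_of_length_le (by
    have : cs.Prefix w (cs.absorbed 1 w) := cs.prefix_absorbed ⟨Prefix.refl w, by simp⟩
    rw [Prefix] at this
    omega)

/-- What `x * y` absorbs from `w` can be found in two stages, first by `y`, then by `x`. This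
identity makes `headAct` multiplicative. -/
theorem absorbed_mul {x y : W} (hxy : cs.length (x * y) = cs.length x + cs.length y) (w : W) :
    cs.absorbed x (y * cs.absorbed y w) = y * cs.absorbed (x * y) w ∧
      cs.Prefix (cs.absorbed (x * y) w) (cs.absorbed y w) := by
  obtain ⟨hp, hl⟩ := cs.isAbsorbed_absorbed y w
  obtain ⟨hp2, hl2⟩ := cs.isAbsorbed_absorbed (x * y) w
  obtain ⟨hp1, hl1⟩ := cs.isAbsorbed_absorbed x (y * cs.absorbed y w)
  have hgy := fun v => cs.prefix_absorbed (x := y) (w := w) (v := v)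
  have hgxy := fun v => cs.prefix_absorbed (x := x * y) (w := w) (v := v)
  have hgx := fun v => cs.prefix_absorbed (x := x) (w := y * cs.absorbed y w) (v := v)
  generalize cs.absorbed x (y * cs.absorbed y w) = a at *
  generalize cs.absorbed (x * y) w = b at *
  generalize cs.absorbed y w = c at *
  have hyb : cs.length (y * b) = cs.length y + cs.length b := by
    have h1 := cs.length_mul_le x (y * b)
    have h2 := cs.length_mul_le y b
    rw [← mul_assoc] at h1
    omega
  have hbc : cs.Prefix b c := hgy b ⟨hp2, hyb⟩
  have hyba : cs.Prefix (y * b) a := by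
    apply hgx
    constructor
    · rw [Prefix, mul_inv_rev, mul_assoc, inv_mul_cancel_left]
      rw [Prefix] at hbc
      omega
    · rw [← mul_assoc]
      omega
  have hya : cs.Prefix y a := (Prefix.mul_of_length_mul hyb).trans hyba
  have hu : cs.IsAbsorbed (x * y) w (y⁻¹ * a) := by
    constructor
    · refine Prefix.trans (v := c) ?_ hp
      rw [Prefix, mul_inv_rev, inv_inv, mul_assoc]
      rw [Prefix] at hp1 hya
      omega
    · rw [mul_assoc, mul_inv_cancel_left]
      rw [Prefix] at hya
      omega
  have hub := hgxy _ hu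
  refine ⟨(hyba.eq_of_length_le ?_).symm, hbc⟩
  rw [Prefix] at hub hya
  omega

end WeakOrder

end CoxeterSystem

namespace ArtinTitsMonoid

open CoxeterSystem

variable {B : Type u} {M : CoxeterMatrix B}

/-! ### The greatest reduced left divisor, and left cancellation -/

theorem redLift_prefix {v w : M.Group} (h : M.toCoxeterSystem.Prefix v w) :
    redLift w = redLift v * redLift (v⁻¹ * w) := by
  rw [← redLift_mul, mul_inv_cancel_left]
  rwa [mul_inv_cancel_left]

/-- Left multiplication by a reduced element, on pairs made of the greatest reduced left divisor
and the remaining part. -/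
noncomputable def headAct (x : M.Group) : Function.End (M.Group × ArtinTitsMonoid M) := fun p =>
  (x * M.toCoxeterSystem.absorbed x p.1,
    redLift ((M.toCoxeterSystem.absorbed x p.1)⁻¹ * p.1) * p.2)

theorem headAct_one : headAct (1 : M.Group) = 1 := by
  funext p
  simp [headAct, absorbed_one, Function.End.one_apply]

/-- Multiplicativity along reduced products is all that the braid relations need, both sides being
reduced words of one group element; so the head map extends to an action of the monoid. -/
theorem headAct_mul {x y : M.Group} (h : M.toCoxeterSystem.length (x * y) =
    M.toCoxeterSystem.length x + M.toCoxeterSystem.length y) :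
    headAct (x * y) = headAct x * headAct y := by
  funext ⟨w, z⟩
  obtain ⟨h1, h2⟩ := M.toCoxeterSystem.absorbed_mul h w
  rw [Function.End.mul_apply]
  simp only [headAct, h1, Prod.mk.injEq]
  refine ⟨by rw [mul_assoc], ?_⟩
  rw [← mul_assoc (redLift _), mul_inv_rev, mul_assoc _ y⁻¹, inv_mul_cancel_left, ← redLift_mul]
  · rw [mul_assoc, mul_inv_cancel_left]
  · rw [mul_assoc, mul_inv_cancel_left,
      h2.length_inv_mul_add (M.toCoxeterSystem.isAbsorbed_absorbed y w).1]

theorem prod_map_headAct_simple {ω : List B} (hω : M.toCoxeterSystem.IsReduced ω) :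
    (ω.map fun i => headAct (M.toCoxeterSystem.simple i)).prod =
      headAct (M.toCoxeterSystem.wordProd ω) := by
  induction ω with
  | nil => exact headAct_one.symm
  | cons i ω ih =>
    have r : M.toCoxeterSystem.IsReduced ω := by simpa using hω.drop 1
    rw [List.map_cons, List.prod_cons, ih r, wordProd_cons, headAct_mul]
    rw [← wordProd_cons, hω.eq, r.eq, length_simple, List.length_cons, add_comm]

/-- The action of the monoid on pairs made of the greatest reduced left divisor and the remaining
part. -/
noncomputable def headHom (M : CoxeterMatrix B) :
    ArtinTitsMonoid M →* Function.End (M.Group × ArtinTitsMonoid M) :=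
  liftHom (fun i => headAct (M.toCoxeterSystem.simple i)) fun i j hij h0 => by
    have hb := M.toCoxeterSystem.wordProd_braidWord_eq i j
    rw [braidWord, braidWord, M.symmetric j i] at hb
    rw [prod_map_headAct_simple (M.toCoxeterSystem.isReduced_alternatingWord hij fun _ => le_rfl),
      prod_map_headAct_simple (M.toCoxeterSystem.isReduced_alternatingWord hij.symm
        fun _ => (M.symmetric i j).le), hb]

theorem headHom_redLift (x : M.Group) : headHom M (redLift x) = headAct x := by
  obtain ⟨ω, hω, rfl⟩ := M.toCoxeterSystem.exists_isReduced x
  rw [redLift_wordProd hω, headHom, liftHom_mkWord, prod_map_headAct_simple hω]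

theorem headHom_gen (i : B) : headHom M (gen M i) = headAct (M.toCoxeterSystem.simple i) := by
  rw [← redLift_simple, headHom_redLift]

/-- A pair stands for the product of its head and its remainder; on these products the action is
left multiplication. -/
theorem redLift_headAct_mul (x : M.Group) (p : M.Group × ArtinTitsMonoid M) :
    redLift (headAct x p).1 * (headAct x p).2 = redLift x * (redLift p.1 * p.2) := by
  obtain ⟨h1, h2⟩ := M.toCoxeterSystem.isAbsorbed_absorbed x p.1
  simp only [headAct]
  rw [redLift_mul h2, redLift_prefix h1]
  simp only [mul_assoc]

theorem redLift_headHom_mul (y : ArtinTitsMonoid M) (p : M.Group × ArtinTitsMonoid M) :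
    redLift (headHom M y p).1 * (headHom M y p).2 = y * (redLift p.1 * p.2) := by
  obtain ⟨ω, rfl⟩ := mkWord_surjective y
  induction ω with
  | nil => simp [Function.End.one_apply]
  | cons i ω ih =>
    rw [mkWord_cons, map_mul, Function.End.mul_apply, headHom_gen, redLift_headAct_mul, ih,
      redLift_simple, mul_assoc]

theorem eq_redLift_mul (z : ArtinTitsMonoid M) :
    redLift (headHom M z (1, 1)).1 * (headHom M z (1, 1)).2 = z := by
  rw [redLift_headHom_mul]
  simp

/-- Every element has a greatest reduced left divisor. -/
theorem exists_greatest_isRed_dvd (z : ArtinTitsMonoid M) :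
    ∃ h, IsRed h ∧ h ∣ z ∧ ∀ x, IsRed x → x ∣ z → x ∣ h := by
  refine ⟨redLift (headHom M z (1, 1)).1, isRed_redLift _, ⟨_, (eq_redLift_mul z).symm⟩, ?_⟩
  rintro x hx ⟨y, rfl⟩
  -- For `z = x * y` with `x` reduced, the computed head is `x` times what `x` absorbs from the head
  -- of `y`, with lengths adding.
  rw [← hx.redLift_proj, map_mul, Function.End.mul_apply, headHom_redLift, headAct, redLift_mul]
  · exact dvd_mul_right _ _
  · exact (M.toCoxeterSystem.isAbsorbed_absorbed _ _).2

/-- The pair computed for `gen M i * z` determines `z`: its head starts with `s_i`, and removing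
that letter leaves a factorization of `z`. -/
theorem gen_mul_left_cancel (i : B) {y y' : ArtinTitsMonoid M}
    (h : gen M i * y = gen M i * y') : y = y' := by
  have key : ∀ z : ArtinTitsMonoid M,
      redLift (M.toCoxeterSystem.simple i * (headHom M (gen M i * z) (1, 1)).1) *
        (headHom M (gen M i * z) (1, 1)).2 = z := by
    intro z
    rw [map_mul, Function.End.mul_apply, headHom_gen, headAct]
    dsimp only
    rw [simple_mul_simple_cancel_left, ← mul_assoc,
      ← redLift_prefix (M.toCoxeterSystem.isAbsorbed_absorbed _ _).1, eq_redLift_mul]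
  rw [← key y, h, key]

instance : IsLeftCancelMul (ArtinTitsMonoid M) where
  mul_left_cancel x y z h := by
    obtain ⟨ω, rfl⟩ := mkWord_surjective x
    induction ω with
    | nil => simpa using h
    | cons i ω ih =>
      apply ih
      simp only [mkWord_cons, mul_assoc] at h
      exact gen_mul_left_cancel i h

/-- Both generators divide the greatest reduced left divisor of `z`, so the question moves to the
Coxeter group, where two left descents force a finite label and a braid prefix. -/
theorem braid_dvd {z : ArtinTitsMonoid M} {i j : B} (hij : i ≠ j) (hi : gen M i ∣ z)
    (hj : gen M j ∣ z) : M i j ≠ 0 ∧ mkWord M (alternatingWord i j (M i j)) ∣ z := by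
  obtain ⟨h, hr, hz, hmax⟩ := exists_greatest_isRed_dvd z
  have desc : ∀ k, gen M k ∣ z → M.toCoxeterSystem.IsLeftDescent (proj M h) k := by
    intro k hk
    obtain ⟨y, rfl⟩ := hmax _ (isRed_gen k) hk
    have h1 : _ = _ := hr
    have h2 := length_proj_le y
    rw [len_mul, len_gen] at h1
    rw [IsLeftDescent, h1, map_mul, proj_gen, simple_mul_simple_cancel_left]
    omega
  refine ⟨M.toCoxeterSystem.coxeterMatrix_ne_zero_of_isLeftDescent hij (desc i hi) (desc j hj), ?_⟩
  obtain ⟨u, hu, hl⟩ := M.toCoxeterSystem.exists_eq_alternatingWord_mul hij (desc i hi) (desc j hj)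
    (M i j) fun _ => le_rfl
  have hd := M.toCoxeterSystem.isReduced_alternatingWord hij (k := M i j) fun _ => le_rfl
  refine dvd_trans ⟨redLift u, ?_⟩ hz
  rw [← hr.redLift_proj, hu, redLift_mul, redLift_wordProd hd]
  rw [← hu, hl, hd.eq, length_alternatingWord]

end ArtinTitsMonoid

namespace ArtinTitsMonoid

open CoxeterSystem

variable {B : Type u} {M : CoxeterMatrix B}

/-! ### Least common multiples -/

theorem dvd_of_mul_dvd_mul {x y z : ArtinTitsMonoid M} (h : x * y ∣ x * z) : y ∣ z := by
  obtain ⟨w, hw⟩ := h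
  exact ⟨w, mul_left_cancel (a := x) (by rw [hw, mul_assoc])⟩

theorem dvd_antisymm' {x y : ArtinTitsMonoid M} (h : x ∣ y) (h' : y ∣ x) : x = y := by
  obtain ⟨z, rfl⟩ := h
  obtain ⟨w, hw⟩ := h'
  have := congrArg len hw
  rw [len_mul, len_mul] at this
  rw [eq_one_of_len_eq_zero (show len z = 0 by omega), mul_one]

theorem IsLeftLub.unique {X : Set (ArtinTitsMonoid M)} {u v : ArtinTitsMonoid M}
    (hu : IsLeftLub X u) (hv : IsLeftLub X v) : u = v :=
  dvd_antisymm' (hu.2 v hv.1) (hv.2 u hu.1)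

theorem isLeftLub_pair_iff {x y d : ArtinTitsMonoid M} :
    IsLeftLub {x, y} d ↔ x ∣ d ∧ y ∣ d ∧ ∀ v, x ∣ v → y ∣ v → d ∣ v := by
  constructor
  · rintro ⟨h1, h2⟩
    refine ⟨h1 x (by simp), h1 y (by simp), fun v hx hy => h2 v ?_⟩
    rintro _ (rfl | rfl)
    · exact hx
    · exact hy
  · rintro ⟨hx, hy, h⟩
    refine ⟨?_, fun v hv => h v (hv x (by simp)) (hv y (by simp))⟩
    rintro _ (rfl | rfl)
    · exact hx
    · exact hy

/-- The least common multiple of two generators. -/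
def braidElt (M : CoxeterMatrix B) (i j : B) : ArtinTitsMonoid M :=
  mkWord M (alternatingWord i j (M i j))

/-- A decomposition of the least common multiple of two generators. -/
theorem exists_braidElt_eq {i j : B} (hij : i ≠ j) (h0 : M i j ≠ 0) :
    ∃ p, braidElt M i j = gen M i * p ∧ gen M j ∣ p ∧ p ∣ braidElt M i j ∧
      (M i j ≠ 2 → i ∈ supp p) := by
  obtain ⟨k, hk⟩ := Nat.exists_eq_add_of_le' (M.two_le_of_ne hij h0)
  have hb := mkWord_braid hij h0
  rw [braidElt, hk] at *
  rcases Nat.even_or_odd k with hk' | hk'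
  · have e1 : mkWord M (alternatingWord i j (k + 1)) = gen M j * mkWord M (alternatingWord i j k) := by
      rw [alternatingWord_succ', if_pos hk', mkWord_cons]
    refine ⟨mkWord M (alternatingWord i j (k + 1)), ?_, ?_, ?_, ?_⟩
    · rw [alternatingWord_succ', if_neg (by simpa [Nat.even_add_one] using hk'), mkWord_cons]
    · exact ⟨_, e1⟩
    · rw [hb, alternatingWord_succ j i, List.concat_eq_append, mkWord_append]
      exact dvd_mul_right _ _
    · intro h2
      rw [mem_supp_mkWord, mem_alternatingWord (by omega)]
      exact Or.inl rfl
  · have e1 : mkWord M (alternatingWord j i (k + 1)) = gen M j * mkWord M (alternatingWord j i k) := by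
      rw [alternatingWord_succ', if_neg (Nat.not_even_iff_odd.mpr hk'), mkWord_cons]
    refine ⟨mkWord M (alternatingWord j i (k + 1)), ?_, ?_, ?_, ?_⟩
    · rw [hb, alternatingWord_succ', if_pos (by simpa [Nat.even_add_one] using hk'), mkWord_cons]
    · exact ⟨_, e1⟩
    · rw [alternatingWord_succ i j, List.concat_eq_append, mkWord_append]
      exact dvd_mul_right _ _
    · intro h2
      rw [mem_supp_mkWord, mem_alternatingWord (by omega)]
      exact Or.inr rfl

theorem braidElt_comm {i j : B} (hij : i ≠ j) (h0 : M i j ≠ 0) :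
    braidElt M i j = braidElt M j i := by
  rw [braidElt, braidElt, mkWord_braid hij h0, M.symmetric j i]

theorem supp_braidElt {i j : B} (hij : i ≠ j) (h0 : M i j ≠ 0) :
    supp (braidElt M i j) = {i, j} := by
  ext x
  rw [braidElt, mem_supp_mkWord, mem_alternatingWord (M.two_le_of_ne hij h0)]
  rfl

theorem isLeftLub_braidElt {i j : B} (hij : i ≠ j) (h0 : M i j ≠ 0) :
    IsLeftLub {gen M i, gen M j} (braidElt M i j) := by
  obtain ⟨p, hp, hj, -, -⟩ := exists_braidElt_eq hij h0
  obtain ⟨q, hq, -, -, -⟩ := exists_braidElt_eq (M := M) hij.symm (by rwa [M.symmetric])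
  exact isLeftLub_pair_iff.mpr ⟨⟨p, hp⟩, ⟨q, by rw [braidElt_comm hij h0, hq]⟩,
    fun v hi hj => (braid_dvd hij hi hj).2⟩

/-- Two elements with a common multiple have a least common multiple. -/
theorem exists_isLeftLub_pair {x y z : ArtinTitsMonoid M} (hx : x ∣ z) (hy : y ∣ z) :
    ∃ d, IsLeftLub {x, y} d ∧ supp d ⊆ supp x ∪ supp y := by
  simp only [isLeftLub_pair_iff]
  induction hn : len z using Nat.strong_induction_on generalizing x y z with
  | _ n ih =>
  subst hn
  by_cases hx1 : x = 1
  · subst hx1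
    exact ⟨y, ⟨one_dvd _, dvd_rfl, fun v _ h => h⟩, by simp⟩
  by_cases hy1 : y = 1
  · subst hy1
    exact ⟨x, ⟨dvd_rfl, one_dvd _, fun v h _ => h⟩, by simp⟩
  obtain ⟨i, x, rfl⟩ := exists_eq_gen_mul hx1
  obtain ⟨j, y, rfl⟩ := exists_eq_gen_mul hy1
  obtain ⟨z', rfl⟩ : gen M i ∣ z := dvd_trans (dvd_mul_right _ _) hx
  replace hx := dvd_of_mul_dvd_mul hx
  have hlen : len z' < len (gen M i * z') := by rw [len_mul, len_gen]; omega
  by_cases hij : i = j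
  · subst hij
    replace hy := dvd_of_mul_dvd_mul hy
    obtain ⟨d, ⟨h1, h2, h3⟩, hs⟩ := ih _ hlen hx hy rfl
    refine ⟨gen M i * d, ⟨mul_dvd_mul_left _ h1, mul_dvd_mul_left _ h2, ?_⟩, ?_⟩
    · rintro v hxv hyv
      obtain ⟨w, rfl⟩ : gen M i ∣ v := dvd_trans (dvd_mul_right _ _) hxv
      exact mul_dvd_mul_left _ (h3 w (dvd_of_mul_dvd_mul hxv) (dvd_of_mul_dvd_mul hyv))
    · simp only [supp_mul]
      intro b hb
      have := @hs b
      simp only [Set.mem_union] at *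
      tauto
  -- Write the braid element as `i p = j q`. A common multiple of `i x` and `j y` is also one of the
  -- braid element, so join `x` with `p` behind `i`, join `y` with `q` to get `q r` behind `j`,
  -- rewrite `j q r = i p r`, and join the two results behind `i`. All these joins lie below shorter
  -- elements.
  · have hjz : gen M j ∣ gen M i * z' := dvd_trans (dvd_mul_right _ _) hy
    obtain ⟨h0, hD⟩ := braid_dvd hij (dvd_mul_right _ _) hjz
    obtain ⟨p, hp, -, -, -⟩ := exists_braidElt_eq hij h0
    obtain ⟨q, hq, -, -, -⟩ := exists_braidElt_eq (M := M) (Ne.symm hij) (by rwa [M.symmetric])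
    rw [← braidElt_comm hij h0] at hq
    rw [← braidElt] at hD
    have hpz : p ∣ z' := by rw [hp] at hD; exact dvd_of_mul_dvd_mul hD
    obtain ⟨l₁, ⟨hx1, hp1, hmin1⟩, hs1⟩ := ih _ hlen hx hpz rfl
    obtain ⟨z'', hz''⟩ := hjz
    have hlen'' : len z'' < len (gen M i * z') := by rw [hz'', len_mul, len_gen]; omega
    have hyz : y ∣ z'' := by rw [hz''] at hy; exact dvd_of_mul_dvd_mul hy
    have hqz : q ∣ z'' := by rw [hq, hz''] at hD; exact dvd_of_mul_dvd_mul hD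
    obtain ⟨l₂, ⟨hy2, hq2, hmin2⟩, hs2⟩ := ih _ hlen'' hyz hqz rfl
    obtain ⟨r, rfl⟩ := hq2
    have e2 : gen M j * (q * r) = gen M i * (p * r) := by
      rw [← mul_assoc, ← hq, hp, mul_assoc]
    have hl1z : l₁ ∣ z' := hmin1 _ hx hpz
    have hl2z : p * r ∣ z' := by
      apply dvd_of_mul_dvd_mul (x := gen M i)
      rw [← e2, hz'']
      exact mul_dvd_mul_left _ (hmin2 _ hyz hqz)
    obtain ⟨l, ⟨h1, h2, h3⟩, hs⟩ := ih _ hlen hl1z hl2z rfl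
    refine ⟨gen M i * l, ⟨mul_dvd_mul_left _ (hx1.trans h1), ?_, ?_⟩, ?_⟩
    · refine (mul_dvd_mul_left _ hy2).trans ?_
      rw [e2]
      exact mul_dvd_mul_left _ h2
    · intro v hxv hyv
      have hiv : gen M i ∣ v := dvd_trans (dvd_mul_right _ _) hxv
      have hjv : gen M j ∣ v := dvd_trans (dvd_mul_right _ _) hyv
      have hDv := (braid_dvd hij hiv hjv).2
      rw [← braidElt] at hDv
      obtain ⟨w, rfl⟩ := hiv
      obtain ⟨w', hw'⟩ := hjv
      apply mul_dvd_mul_left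
      apply h3
      · apply hmin1 _ (dvd_of_mul_dvd_mul hxv)
        rw [hp] at hDv
        exact dvd_of_mul_dvd_mul hDv
      · apply dvd_of_mul_dvd_mul (x := gen M i)
        rw [← e2, hw']
        apply mul_dvd_mul_left
        rw [hw'] at hyv hDv
        rw [hq] at hDv
        exact hmin2 _ (dvd_of_mul_dvd_mul hyv) (dvd_of_mul_dvd_mul hDv)
    · have sp : supp p ⊆ {i, j} := by
        rw [← supp_braidElt hij h0, hp, supp_mul]
        exact Set.subset_union_right
      have sq : supp q ⊆ {i, j} := by
        rw [← supp_braidElt hij h0, hq, supp_mul]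
        exact Set.subset_union_right
      have hU : ({i, j} : Set B) ⊆ supp (gen M i * x) ∪ supp (gen M j * y) := by
        simp only [supp_mul, supp_gen]
        rintro b (rfl | rfl)
        · exact Or.inl (Or.inl rfl)
        · exact Or.inr (Or.inl rfl)
      have hxU : supp x ⊆ supp (gen M i * x) ∪ supp (gen M j * y) := by
        rw [supp_mul (gen M i)]
        exact fun b hb => Or.inl (Or.inr hb)
      have hyU : supp y ⊆ supp (gen M i * x) ∪ supp (gen M j * y) := by
        rw [supp_mul (gen M j)]
        exact fun b hb => Or.inr (Or.inr hb)
      have hl1 := hs1.trans (Set.union_subset hxU (sp.trans hU))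
      have hl2 := hs2.trans (Set.union_subset hyU (sq.trans hU))
      have hpr : supp (p * r) ⊆ supp (gen M i * x) ∪ supp (gen M j * y) := by
        have hsub : supp (p * r) ⊆ supp (gen M j * (q * r)) := by
          rw [e2, supp_mul (gen M i)]
          exact Set.subset_union_right
        refine hsub.trans ?_
        rw [supp_mul (gen M j) (q * r), supp_gen]
        refine Set.union_subset ?_ hl2
        rintro b rfl
        exact hU (Or.inr rfl)
      rw [supp_mul (gen M i) l, supp_gen]
      refine Set.union_subset ?_ (hs.trans (Set.union_subset hl1 hpr))
      rintro b rfl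
      exact hU (Or.inl rfl)

/-! ### Simple elements -/

theorem gen_mem_simples (i : B) : gen M i ∈ simples M :=
  (simples_isLeast M).1.generators_subset ⟨i, rfl⟩

theorem lub_mem_simples {x y d : ArtinTitsMonoid M} (hx : x ∈ simples M) (hy : y ∈ simples M)
    (hd : IsLeftLub {x, y} d) : d ∈ simples M :=
  (simples_isLeast M).1.lub_mem x hx y hy d hd

theorem mem_simples_of_mul {x y : ArtinTitsMonoid M} (h : x * y ∈ simples M) : y ∈ simples M :=
  (simples_isLeast M).1.rightDvd_mem _ h y ⟨x, rfl⟩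

/-- Closure under joins: the greatest reduced left divisor of a join of two reduced elements is a
multiple of both, hence is the join. -/
theorem isGarsideSubset_isRed : IsGarsideSubset {x : ArtinTitsMonoid M | IsRed x} where
  generators_subset := by
    rintro _ ⟨i, rfl⟩
    exact isRed_gen i
  lub_mem x hx y hy d hd := by
    obtain ⟨hxd, hyd, hmin⟩ := isLeftLub_pair_iff.mp hd
    obtain ⟨h, hr, hhd, hmax⟩ := exists_greatest_isRed_dvd d
    rwa [dvd_antisymm' (hmin h (hmax x hx hxd) (hmax y hy hyd)) hhd]
  rightDvd_mem := by
    rintro _ hx y ⟨z, rfl⟩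
    exact IsRed.of_mul hx |>.2

theorem isRed_of_mem_simples {x : ArtinTitsMonoid M} (hx : x ∈ simples M) : IsRed x :=
  (simples_isLeast M).2 isGarsideSubset_isRed hx

/-- If the letter `i` does not occur in `u`, then a common multiple of `gen M i` and `u` is a
multiple of `u * gen M i`. -/
theorem mul_gen_dvd {i : B} {u z : ArtinTitsMonoid M} (hu : u ∣ z) (hi : gen M i ∣ z)
    (his : i ∉ supp u) : u * gen M i ∣ z := by
  obtain ⟨ω, rfl⟩ := mkWord_surjective u
  induction ω generalizing z with
  | nil => simpa using hi
  | cons j ω ih =>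
    rw [mkWord_cons] at hu his ⊢
    rw [supp_mul, supp_gen, Set.mem_union, Set.mem_singleton_iff, not_or] at his
    have hj : gen M j ∣ z := dvd_trans (dvd_mul_right _ _) hu
    -- The braid element is `j p` with `p` divisible by `i`; so after removing the first letter `j`
    -- of `u` from `z`, the letter `i` still divides the quotient.
    obtain ⟨h0, hD⟩ := braid_dvd (Ne.symm his.1) hj hi
    obtain ⟨p, hp, hip, -, -⟩ := exists_braidElt_eq (Ne.symm his.1) h0
    rw [← braidElt, hp] at hD
    obtain ⟨w, rfl⟩ := hj
    rw [mul_assoc]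
    exact mul_dvd_mul_left _
      (ih (hip.trans (dvd_of_mul_dvd_mul hD)) (dvd_of_mul_dvd_mul hu) his.2)

theorem exists_eq_mul_gen_mul {i : B} {x : ArtinTitsMonoid M} (h : i ∈ supp x) :
    ∃ u v, x = u * (gen M i * v) ∧ i ∉ supp u := by
  obtain ⟨ω, rfl⟩ := mkWord_surjective x
  rw [mem_supp_mkWord] at h
  obtain ⟨ω₁, ω₂, rfl, h'⟩ := List.eq_append_cons_of_mem h
  exact ⟨mkWord M ω₁, mkWord M ω₂, by rw [mkWord_append, mkWord_cons], by rwa [mem_supp_mkWord]⟩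

/-- Cut `x` before its first `i` and `y` before its first `j`. The join `t` of these initial parts
contains neither letter, so `mul_gen_dvd` pushes both letters past it: `t * i` and `t * j` divide
`z`, and `braid_dvd` applies behind `t`. -/
theorem ne_zero_of_common_multiple {i j : B} (hij : i ≠ j) {x y z : ArtinTitsMonoid M}
    (hx : x ∣ z) (hy : y ∣ z) (hi : i ∈ supp x) (hj : j ∈ supp y) (hi' : i ∉ supp y)
    (hj' : j ∉ supp x) : M i j ≠ 0 := by
  obtain ⟨x₁, x₂, rfl, hx₁⟩ := exists_eq_mul_gen_mul hi
  obtain ⟨y₁, y₂, rfl, hy₁⟩ := exists_eq_mul_gen_mul hj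
  simp only [supp_mul, Set.mem_union, not_or] at hi' hj'
  have hxz : x₁ ∣ z := dvd_trans (dvd_mul_right _ _) hx
  have hyz : y₁ ∣ z := dvd_trans (dvd_mul_right _ _) hy
  obtain ⟨t, ht, hs⟩ := exists_isLeftLub_pair hxz hyz
  obtain ⟨hxt, hyt, hmin⟩ := isLeftLub_pair_iff.mp ht
  have htz := hmin z hxz hyz
  have key : ∀ (k : B) (w v : ArtinTitsMonoid M), w ∣ t → w * (gen M k * v) ∣ z → k ∉ supp t →
      t * gen M k ∣ z := by
    rintro k w v ⟨u, rfl⟩ hwz hk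
    obtain ⟨z₁, rfl⟩ : w ∣ z := dvd_trans (dvd_mul_right _ _) hwz
    rw [mul_assoc]
    refine mul_dvd_mul_left _ (mul_gen_dvd (dvd_of_mul_dvd_mul htz)
      (dvd_trans (dvd_mul_right _ _) (dvd_of_mul_dvd_mul hwz)) fun h => hk ?_)
    rw [supp_mul]
    exact Or.inr h
  have h1 := key i x₁ x₂ hxt hx fun h => (hs h).elim hx₁ hi'.1
  have h2 := key j y₁ y₂ hyt hy fun h => (hs h).elim hj'.1 hy₁
  obtain ⟨z₂, rfl⟩ := htz
  exact (braid_dvd hij (dvd_of_mul_dvd_mul h1) (dvd_of_mul_dvd_mul h2)).1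

/-- A pair of letters with label `∞` in a join would either lie in one of the two elements, or be
split between them, which `ne_zero_of_common_multiple` excludes. -/
theorem isGarsideSubset_ne_zero :
    IsGarsideSubset {x : ArtinTitsMonoid M | ∀ i ∈ supp x, ∀ j ∈ supp x, M i j ≠ 0} where
  generators_subset := by
    rintro _ ⟨i, rfl⟩
    change ∀ a ∈ supp (gen M i), ∀ b ∈ supp (gen M i), M a b ≠ 0
    simp
  lub_mem x hx y hy d hd i hi j hj h0 := by
    have hij : i ≠ j := by
      rintro rfl
      simp at h0
    obtain ⟨hxd, hyd, hmin⟩ := isLeftLub_pair_iff.mp hd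
    obtain ⟨d', hd', hs⟩ := exists_isLeftLub_pair hxd hyd
    rw [hd'.unique hd] at hs
    have h0' : M j i = 0 := by rwa [M.symmetric]
    by_cases hix : i ∈ supp x
    · by_cases hjx : j ∈ supp x
      · exact hx i hix j hjx h0
      · have hjy := (hs hj).resolve_left hjx
        by_cases hiy : i ∈ supp y
        · exact hy i hiy j hjy h0
        · exact ne_zero_of_common_multiple hij hxd hyd hix hjy hiy hjx h0
    · have hiy := (hs hi).resolve_left hix
      by_cases hjy : j ∈ supp y
      · exact hy i hiy j hjy h0
      · have hjx := (hs hj).resolve_right hjy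
        exact ne_zero_of_common_multiple hij.symm hxd hyd hjx hiy hjy hix h0'
  rightDvd_mem := by
    rintro _ hx y ⟨z, rfl⟩ i hi j hj
    apply hx <;> rw [supp_mul]
    · exact Or.inr hi
    · exact Or.inr hj

theorem ne_zero_of_mem_simples {x : ArtinTitsMonoid M} (hx : x ∈ simples M) {i j : B}
    (hi : i ∈ supp x) (hj : j ∈ supp x) : M i j ≠ 0 :=
  (simples_isLeast M).2 isGarsideSubset_ne_zero hx i hi j hj

/-- Otherwise `x * u` would contain the square of a generator and not be reduced. -/
theorem eq_one_of_mul_gen_mul_mem {x u : ArtinTitsMonoid M} (hxu : x * u ∈ simples M)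
    (h : ∀ i, gen M i ∣ u → ∃ x', x = x' * gen M i) : u = 1 := by
  by_contra hu
  obtain ⟨i, u', rfl⟩ := exists_eq_gen_mul hu
  obtain ⟨x', rfl⟩ := h i (dvd_mul_right _ _)
  exact not_isRed_mul_gen_mul_gen_mul _ _ _ (isRed_of_mem_simples hxu)

theorem gen_mul_gen_mem_simples {i j : B} (hij : i ≠ j) (h0 : M i j ≠ 0) :
    gen M i * gen M j ∈ simples M := by
  have h := lub_mem_simples (gen_mem_simples i) (gen_mem_simples j) (isLeftLub_braidElt hij h0)
  obtain ⟨k, hk⟩ := Nat.exists_eq_add_of_le' (M.two_le_of_ne hij h0)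
  rw [braidElt, hk, alternatingWord_succ, alternatingWord_succ, List.concat_eq_append,
    List.concat_eq_append, mkWord_append, mkWord_append, mul_assoc] at h
  exact mem_simples_of_mul h

/-- The least common multiple of a set of generators; the left multiplication by a simple
element. -/
theorem exists_lub_gens {x : ArtinTitsMonoid M} (hx : x ∈ simples M) (J : Finset B)
    (hJ : ∀ i ∈ J, x * gen M i ∈ simples M) {z : ArtinTitsMonoid M} (hz : ∀ i ∈ J, gen M i ∣ z) :
    ∃ D, IsLeftLub (gen M '' J) D ∧ supp D ⊆ J ∧ x * D ∈ simples M := by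
  classical
  induction J using Finset.induction_on with
  | empty => exact ⟨1, ⟨by simp, fun v _ => ⟨v, by simp⟩⟩, by simp, by simpa using hx⟩
  | insert i J hi ih =>
    obtain ⟨D, ⟨hD, hmin⟩, hs, hm⟩ := ih (fun k hk => hJ k (Finset.mem_insert_of_mem hk))
      fun k hk => hz k (Finset.mem_insert_of_mem hk)
    have hDz : D ∣ z := hmin z (by
      rintro _ ⟨k, hk, rfl⟩
      exact hz k (Finset.mem_insert_of_mem hk))
    obtain ⟨D', hD', hs'⟩ := exists_isLeftLub_pair hDz (hz i (Finset.mem_insert_self i J))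
    obtain ⟨h1, h2, h3⟩ := isLeftLub_pair_iff.mp hD'
    refine ⟨D', ⟨?_, ?_⟩, ?_, ?_⟩
    · rintro _ ⟨k, hk, rfl⟩
      rcases Finset.mem_insert.mp hk with rfl | hk
      · exact h2
      · exact dvd_trans (hD _ ⟨k, hk, rfl⟩) h1
    · intro v hv
      refine h3 v (hmin v ?_) (hv _ ⟨i, by simp, rfl⟩)
      rintro _ ⟨k, hk, rfl⟩
      exact hv _ ⟨k, by simpa using Or.inr hk, rfl⟩
    · intro k hk
      have := hs' hk
      rw [supp_gen] at this
      rw [Finset.coe_insert]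
      rcases this with h | h
      · exact Or.inr (hs h)
      · exact Or.inl h
    · refine lub_mem_simples hm (hJ i (Finset.mem_insert_self i J)) (isLeftLub_pair_iff.mpr
        ⟨mul_dvd_mul_left _ h1, mul_dvd_mul_left _ h2, ?_⟩)
      intro v hv1 hv2
      obtain ⟨w, rfl⟩ : x ∣ v := dvd_trans (dvd_mul_right _ _) hv1
      exact mul_dvd_mul_left _ (h3 w (dvd_of_mul_dvd_mul hv1) (dvd_of_mul_dvd_mul hv2))

/-- The least common multiple of a set of generators is right divisible by these generators. -/
theorem exists_eq_mul_gen_of_isLeftLub {J : Finset B} {D : ArtinTitsMonoid M}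
    (hD : IsLeftLub (gen M '' J) D) (hs : supp D ⊆ J) {i : B} (hi : i ∈ J) :
    ∃ D', D = D' * gen M i := by
  -- Conjugation by `D` permutes `J`. Indeed every generator in `J` divides `a D`, so `a D = D f`,
  -- and `f` has length one. The map is injective, hence surjective by finiteness, so every letter
  -- of `J` occurs as a last letter of `D`.
  have key : ∀ a : J, ∃ b : J, gen M a * D = D * gen M b ∧ ∃ s, D = s * gen M b := by
    rintro ⟨a, ha⟩
    have haD : gen M a ∣ D := hD.1 _ ⟨a, ha, rfl⟩
    have h1 : D ∣ gen M a * D := by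
      apply hD.2
      rintro _ ⟨b, hb, rfl⟩
      by_cases hab : a = b
      · subst hab
        exact dvd_mul_right _ _
      obtain ⟨h0, hd⟩ := braid_dvd hab haD (hD.1 _ ⟨b, hb, rfl⟩)
      obtain ⟨p, hp, -, hpd, -⟩ := exists_braidElt_eq hab h0
      have hbd : gen M b ∣ braidElt M a b := (isLeftLub_pair_iff.mp (isLeftLub_braidElt hab h0)).2.1
      rw [hp] at hbd
      exact hbd.trans (mul_dvd_mul_left _ (hpd.trans hd))
    obtain ⟨f, hf⟩ := h1
    have hl := congrArg len hf
    rw [len_mul, len_mul, len_gen] at hl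
    obtain ⟨b, rfl⟩ := exists_eq_gen_of_len_eq_one (show len f = 1 by omega)
    obtain ⟨s, hs'⟩ := haD
    have hDb : D = s * gen M b := by
      apply mul_left_cancel (a := gen M a)
      rw [hf, ← mul_assoc, ← hs']
    refine ⟨⟨b, hs ?_⟩, hf, s, hDb⟩
    rw [hDb, supp_mul, supp_gen]
    exact Or.inr rfl
  choose φ hφ hφ' using key
  have hinj : Function.Injective φ := by
    intro a b hab
    have h := hφ a
    rw [hab, ← hφ b] at h
    -- Only left cancellation is available in the monoid, so the right factor `D` is cancelled in
    -- the Coxeter group.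
    have h' := congrArg (proj M) h
    rw [map_mul, map_mul, mul_left_inj, proj_gen, proj_gen] at h'
    have h'' := congrArg redLift h'
    rw [redLift_simple, redLift_simple] at h''
    exact Subtype.ext (gen_injective h'')
  obtain ⟨a, ha⟩ := Finite.injective_iff_surjective.mp hinj ⟨i, hi⟩
  have := hφ' a
  rwa [ha] at this

end ArtinTitsMonoid

/-! ### Moving holes on a connected graph -/

section Tokens

variable {V : Type*} [Finite V] {G : SimpleGraph V}

theorem SimpleGraph.ncard_move_le {I : Set V} {b p : V} (hp : p ∈ I) (hbp : G.Adj b p) :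
    (insert b {x ∈ I | ¬ G.Adj b x}).ncard ≤ I.ncard := by
  have h1 : {x ∈ I | ¬ G.Adj b x} ⊆ I \ {p} := by
    rintro x ⟨hx, hbx⟩
    refine ⟨hx, ?_⟩
    rintro rfl
    exact hbx hbp
  have h2 := Set.ncard_le_ncard h1 (Set.toFinite _)
  have h3 := Set.ncard_sdiff_singleton_add_one hp (Set.toFinite _)
  have h4 := Set.ncard_insert_le b {x ∈ I | ¬ G.Adj b x}
  omega

theorem SimpleGraph.ncard_move_lt {I : Set V} {b p q : V} (hp : p ∈ I) (hbp : G.Adj b p)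
    (hq : q ∈ I) (hbq : G.Adj b q) (hpq : p ≠ q) :
    (insert b {x ∈ I | ¬ G.Adj b x}).ncard < I.ncard := by
  have h1 : {x ∈ I | ¬ G.Adj b x} ⊆ (I \ {p}) \ {q} := by
    rintro x ⟨hx, hbx⟩
    refine ⟨⟨hx, ?_⟩, ?_⟩
    · rintro rfl
      exact hbx hbp
    · rintro rfl
      exact hbx hbq
  have h2 := Set.ncard_le_ncard h1 (Set.toFinite _)
  have h3 := Set.ncard_sdiff_singleton_add_one hp (Set.toFinite _)
  have h4 := Set.ncard_insert_le b {x ∈ I | ¬ G.Adj b x}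
  have h5 := Set.ncard_sdiff_singleton_add_one (s := I \ {p}) (a := q) ⟨hq, hpq.symm⟩
    (Set.toFinite _)
  omega

/-- An induction principle for the nonempty proper subsets of the vertices of a connected graph:
to prove a property of `I` one may add a vertex `b` outside `I` that has a neighbour in `I`, and
remove from `I` the neighbours of `b`. -/
theorem SimpleGraph.Preconnected.move_induction (hG : G.Preconnected) {P : Set V → Prop}
    (single : ∀ v, P {v})
    (move : ∀ (I : Set V) (b : V), b ∉ I → (∃ p ∈ I, G.Adj b p) →
      P (insert b {x ∈ I | ¬ G.Adj b x}) → P I)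
    {I : Set V} (hne : I.Nonempty) (huniv : I ≠ Set.univ) : P I := by
  induction hn : I.ncard using Nat.strong_induction_on generalizing I with
  | _ n ih =>
  have proper : ∀ (J : Set V) (b p : V), G.Adj b p →
      insert b {x ∈ J | ¬ G.Adj b x} ≠ Set.univ := by
    intro J b p hbp h
    have hp : p ∈ insert b {x ∈ J | ¬ G.Adj b x} := h ▸ Set.mem_univ p
    rcases hp with rfl | hp
    · exact G.loopless.irrefl _ hbp
    · exact hp.2 hbp
  -- A walk from `a` to a hole leaves the set of members having a neighbour in `J`, at some step
  -- from `p` to `h`; then `h` is a hole, and `p` has a neighbour `q` in `J`. Inserting `h` removes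
  -- `p`. If `q` survives, inserting `p` again removes both `h` and `q`. Either way the set has
  -- shrunk.
  have adjacent : ∀ J : Set V, J.ncard ≤ n → J ≠ Set.univ → ∀ a ∈ J, ∀ c ∈ J, G.Adj a c → P J := by
    intro J hJ hJu a ha c hc hac
    obtain ⟨z, hz⟩ := (Set.ne_univ_iff_exists_notMem J).mp hJu
    obtain ⟨w⟩ := hG a z
    obtain ⟨d, -, ⟨hpJ, q, hqJ, hpq⟩, hd⟩ := w.exists_boundary_dart
      {x | x ∈ J ∧ ∃ y ∈ J, G.Adj x y} ⟨ha, c, hc, hac⟩ fun h => hz h.1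
    have hph := d.adj
    generalize d.fst = p at *
    generalize d.snd = h at *
    have hhJ : h ∉ J := fun hh => hd ⟨hh, p, hpJ, hph.symm⟩
    apply move J h hhJ ⟨p, hpJ, hph.symm⟩
    by_cases hhq : G.Adj h q
    · have := SimpleGraph.ncard_move_lt hpJ hph.symm hqJ hhq hpq.ne
      exact ih _ (by omega) ⟨h, Set.mem_insert _ _⟩ (proper J h p hph.symm) rfl
    · have hle := SimpleGraph.ncard_move_le hpJ hph.symm
      have hpJ' : p ∉ insert h {x ∈ J | ¬ G.Adj h x} := by
        rintro (hp | hp)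
        · exact hph.ne hp
        · exact hp.2 hph.symm
      have hqJ' : q ∈ insert h {x ∈ J | ¬ G.Adj h x} := Or.inr ⟨hqJ, hhq⟩
      have hhJ' : h ∈ insert h {x ∈ J | ¬ G.Adj h x} := Or.inl rfl
      generalize insert h {x ∈ J | ¬ G.Adj h x} = J' at *
      apply move J' p hpJ' ⟨h, hhJ', hph⟩
      have := SimpleGraph.ncard_move_lt hhJ' hph hqJ' hpq (by rintro rfl; exact hhJ hqJ)
      exact ih _ (by omega) ⟨p, Set.mem_insert _ _⟩ (proper J' p h hph) rfl
  -- Slide the member `p` along a walk towards `q`. Either the next vertex is already in the set,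
  -- which is the adjacent case, or it is a neighbour of `q` and replaces both, or the slide goes on
  -- without increasing the set.
  have walk : ∀ (p q : V) (w : G.Walk p q) (J : Set V), J.ncard ≤ n → J ≠ Set.univ → p ∈ J →
      q ∈ J → p ≠ q → P J := by
    intro p q w
    induction w with
    | nil => exact fun J _ _ _ _ h => absurd rfl h
    | @cons p v q hpv w ihw =>
      intro J hJ hJu hp hq hpq
      by_cases hv : v ∈ J
      · exact adjacent J hJ hJu p hp v hv hpv
      apply move J v hv ⟨p, hp, hpv.symm⟩
      by_cases hvq : G.Adj v q
      · have := SimpleGraph.ncard_move_lt hp hpv.symm hq hvq hpq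
        exact ih _ (by omega) ⟨v, Set.mem_insert _ _⟩ (proper J v p hpv.symm) rfl
      · exact ihw _ ((SimpleGraph.ncard_move_le hp hpv.symm).trans hJ) (proper J v p hpv.symm)
          (Or.inl rfl) (Or.inr ⟨hq, hvq⟩) (by rintro rfl; exact hv hq)
  obtain ⟨p, hp⟩ := hne
  by_cases hs : ∃ q ∈ I, p ≠ q
  · obtain ⟨q, hq, hpq⟩ := hs
    obtain ⟨w⟩ := hG p q
    exact walk p q w I hn.le huniv hp hq hpq
  · push Not at hs
    have : I = {p} := by
      ext x
      exact ⟨fun hx => (hs x hx).symm, fun hx => hx ▸ hp⟩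
    rw [this]
    exact single p

end Tokens

/-! ### Parabolic submonoids, direct products, and connectedness of the Coxeter graph. -/

theorem CoxeterSystem.map_alternatingWord {B B' : Type*} (f : B → B') (i j : B) (m : ℕ) :
    (alternatingWord i j m).map f = alternatingWord (f i) (f j) m := by
  induction m generalizing i j with
  | zero => rfl
  | succ m ih => rw [alternatingWord_succ, alternatingWord_succ, List.map_concat, ih]

namespace CoxeterMatrix

variable {B : Type u} (M : CoxeterMatrix B)

/-- The Coxeter graph, whose edges are the pairs of noncommuting generators. -/
def graph : SimpleGraph B where
  Adj i j := i ≠ j ∧ M i j ≠ 2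
  symm := ⟨fun i j h => ⟨h.1.symm, by rw [M.symmetric]; exact h.2⟩⟩
  loopless := ⟨fun _ h => h.1 rfl⟩

/-- The restriction of a Coxeter matrix to a subset of the index set. -/
def restrict (p : B → Prop) : CoxeterMatrix {i // p i} where
  M := fun i j => M i j
  isSymm := by
    ext i j
    exact M.symmetric _ _
  diagonal i := M.diagonal i
  off_diagonal i j h := M.off_diagonal i j fun h' => h (Subtype.ext h')

end CoxeterMatrix

namespace ArtinTitsMonoid

open CoxeterSystem

variable {B : Type u} {M : CoxeterMatrix B}

theorem prod_map_gen (ω : List B) : (ω.map (gen M)).prod = mkWord M ω := by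
  induction ω with
  | nil => rfl
  | cons i ω ih => rw [List.map_cons, List.prod_cons, ih, mkWord_cons]

/-- The inclusion of a standard parabolic submonoid. -/
def parabolicIncl (M : CoxeterMatrix B) (p : B → Prop) :
    ArtinTitsMonoid (M.restrict p) →* ArtinTitsMonoid M :=
  liftHom (fun i => gen M i) fun i j hij h0 => by
    have h : ∀ ω : List {i // p i}, (ω.map fun i => gen M i.1).prod =
        mkWord M (ω.map Subtype.val) := by
      intro ω
      rw [← prod_map_gen, List.map_map]
      rfl
    rw [h, h, map_alternatingWord, map_alternatingWord]
    exact mkWord_braid (fun h' => hij (Subtype.ext h')) h0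

theorem liftHom_gen {N : Type*} [Monoid N] (f : B → N)
    (h : ∀ i j, i ≠ j → M i j ≠ 0 → ((alternatingWord i j (M i j)).map f).prod =
      ((alternatingWord j i (M i j)).map f).prod) (i : B) :
    liftHom f h (gen M i) = f i := by
  rw [← mkWord_singleton, liftHom_mkWord]
  simp

theorem parabolicIncl_gen (p : B → Prop) (i : {i // p i}) :
    parabolicIncl M p (gen _ i) = gen M i := liftHom_gen _ _ i

open Classical in
/-- The decomposition of an Artin–Tits monoid along a union of components of its Coxeter graph. -/
noncomputable def splitHom (M : CoxeterMatrix B) (p : B → Prop)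
    (hp : ∀ i j, p i → ¬ p j → M i j = 2) :
    ArtinTitsMonoid M →* ArtinTitsMonoid (M.restrict p) × ArtinTitsMonoid (M.restrict (¬ p ·)) :=
  liftHom (fun i => if h : p i then (gen _ ⟨i, h⟩, 1) else (1, gen _ ⟨i, h⟩)) fun i j hij h0 => by
    have two : ∀ a b : B, alternatingWord a b 2 = [a, b] := fun _ _ => rfl
    by_cases hi : p i <;> by_cases hj : p j
    · have h : ∀ ω : List {i // p i}, ((ω.map Subtype.val).map fun i =>
          if h : p i then ((gen _ ⟨i, h⟩, 1) : ArtinTitsMonoid (M.restrict p) ×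
            ArtinTitsMonoid (M.restrict (¬ p ·))) else (1, gen _ ⟨i, h⟩)).prod =
          (mkWord _ ω, 1) := by
        intro ω
        induction ω with
        | nil => rfl
        | cons a ω ih =>
          rw [List.map_cons, List.map_cons, List.prod_cons, ih]
          simp [a.2, mkWord_cons]
      have e := map_alternatingWord (Subtype.val : {i // p i} → B) ⟨i, hi⟩ ⟨j, hj⟩ (M i j)
      have e' := map_alternatingWord (Subtype.val : {i // p i} → B) ⟨j, hj⟩ ⟨i, hi⟩ (M i j)
      dsimp only at e e'
      rw [← e, ← e', h, h]
      congr 1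
      exact mkWord_braid (M := M.restrict p) (fun h' => hij (congrArg Subtype.val h')) h0
    · rw [hp i j hi hj, two, two]
      simp [hi, hj]
    · rw [M.symmetric, hp j i hj hi, two, two]
      simp [hi, hj]
    · have h : ∀ ω : List {i // ¬ p i}, ((ω.map Subtype.val).map fun i =>
          if h : p i then ((gen _ ⟨i, h⟩, 1) : ArtinTitsMonoid (M.restrict p) ×
            ArtinTitsMonoid (M.restrict (¬ p ·))) else (1, gen _ ⟨i, h⟩)).prod =
          (1, mkWord _ ω) := by
        intro ω
        induction ω with
        | nil => rfl
        | cons a ω ih =>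
          rw [List.map_cons, List.map_cons, List.prod_cons, ih]
          simp [a.2, mkWord_cons]
      have e := map_alternatingWord (Subtype.val : {i // ¬ p i} → B) ⟨i, hi⟩ ⟨j, hj⟩ (M i j)
      have e' := map_alternatingWord (Subtype.val : {i // ¬ p i} → B) ⟨j, hj⟩ ⟨i, hi⟩ (M i j)
      dsimp only at e e'
      rw [← e, ← e', h, h]
      congr 1
      exact mkWord_braid (M := M.restrict (¬ p ·)) (fun h' => hij (congrArg Subtype.val h')) h0

theorem commute_parabolicIncl (p : B → Prop) (hp : ∀ i j, p i → ¬ p j → M i j = 2)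
    (x : ArtinTitsMonoid (M.restrict p)) (y : ArtinTitsMonoid (M.restrict (¬ p ·))) :
    Commute (parabolicIncl M p x) (parabolicIncl M (¬ p ·) y) := by
  obtain ⟨ω, rfl⟩ := mkWord_surjective x
  obtain ⟨ω', rfl⟩ := mkWord_surjective y
  rw [parabolicIncl, parabolicIncl, liftHom_mkWord, liftHom_mkWord]
  refine Commute.list_prod_left _ _ fun a ha => Commute.list_prod_right _ _ fun b hb => ?_
  obtain ⟨i, -, rfl⟩ := List.mem_map.mp ha
  obtain ⟨j, -, rfl⟩ := List.mem_map.mp hb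
  have h2 := hp i j i.2 j.2
  have hb := mkWord_braid (M := M) (i := i.1) (j := j.1)
    (by rintro h; exact j.2 (h ▸ i.2)) (by rw [h2]; decide)
  rw [h2] at hb
  exact hb

/-- An Artin–Tits monoid is the product of two parabolic submonoids that commute. -/
noncomputable def splitEquiv (M : CoxeterMatrix B) (p : B → Prop)
    (hp : ∀ i j, p i → ¬ p j → M i j = 2) :
    ArtinTitsMonoid M ≃* ArtinTitsMonoid (M.restrict p) × ArtinTitsMonoid (M.restrict (¬ p ·)) :=
  MonoidHom.toMulEquiv (splitHom M p hp)
    (MonoidHom.noncommCoprod _ _ (commute_parabolicIncl p hp))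
    (by
      apply PresentedMonoid.ext
      intro i
      change (MonoidHom.noncommCoprod _ _ (commute_parabolicIncl p hp)) (splitHom M p hp (gen M i)) = gen M i
      rw [splitHom, liftHom_gen]
      split_ifs with h
      · simp [parabolicIncl_gen]
      · simp [parabolicIncl_gen])
    (by
      have h1 : (splitHom M p hp).comp (parabolicIncl M p) = MonoidHom.inl _ _ := by
        apply PresentedMonoid.ext
        intro i
        change splitHom M p hp (parabolicIncl M p (gen _ i)) = (gen _ i, 1)
        rw [parabolicIncl_gen, splitHom, liftHom_gen, dif_pos i.2]
      have h2 : (splitHom M p hp).comp (parabolicIncl M (¬ p ·)) = MonoidHom.inr _ _ := by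
        apply PresentedMonoid.ext
        intro i
        change splitHom M p hp (parabolicIncl M (¬ p ·) (gen _ i)) = (1, gen _ i)
        rw [parabolicIncl_gen, splitHom, liftHom_gen, dif_neg i.2]
      apply MonoidHom.ext
      rintro ⟨x, y⟩
      have e1 := DFunLike.congr_fun h1 x
      have e2 := DFunLike.congr_fun h2 y
      simp only [MonoidHom.comp_apply, MonoidHom.inl_apply, MonoidHom.inr_apply] at e1 e2
      simp [MonoidHom.noncommCoprod_apply, e1, e2])

/-- Letters inside and outside a connected component commute, so a proper component would split off
as a direct factor. -/
theorem IsIrreducible.preconnected_graph [Finite B] (h : IsIrreducible M) :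
    M.graph.Preconnected := by
  intro i j
  by_contra hij
  have hp : ∀ a b, M.graph.Reachable i a → ¬ M.graph.Reachable i b → M a b = 2 := by
    intro a b ha hb
    by_contra hab
    apply hb
    refine ha.trans (SimpleGraph.Adj.reachable ⟨?_, hab⟩)
    rintro rfl
    exact hb ha
  have : Nonempty {a // M.graph.Reachable i a} := ⟨⟨i, SimpleGraph.Reachable.refl i⟩⟩
  have : Nonempty {a // ¬ M.graph.Reachable i a} := ⟨⟨j, hij⟩⟩
  exact (h _ _ _ _).elim (splitEquiv M _ hp)

end ArtinTitsMonoid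

namespace ArtinTitsMonoid

open CoxeterSystem

variable {B : Type u} {M : CoxeterMatrix B}

/-! ### Normal sequences and the Charney graph -/

/-- `x` is the greatest simple left divisor of `z`. -/
def IsHead (x z : ArtinTitsMonoid M) : Prop :=
  x ∣ z ∧ ∀ ζ ∈ simples M, ζ ∣ z → ζ ∣ x

theorem IsHead.isLeftLub {x z : ArtinTitsMonoid M} (hx : x ∈ simples M) (h : IsHead x z) :
    IsLeftLub {ζ | ζ ∈ simples M ∧ LeftDvd ζ z} x :=
  ⟨fun ζ hζ => h.2 ζ hζ.1 hζ.2, fun _ hv => hv x ⟨hx, h.1⟩⟩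

/-- The join of `x` with a simple divisor of `x * z` is simple and of the form `x * u` with `u ∣ z`.
-/
theorem isHead_mul {x z : ArtinTitsMonoid M} (hx : x ∈ simples M)
    (h : ∀ u, x * u ∈ simples M → u ∣ z → u = 1) : IsHead x (x * z) := by
  refine ⟨dvd_mul_right _ _, fun ζ hζ hζz => ?_⟩
  obtain ⟨d, hd, -⟩ := exists_isLeftLub_pair (dvd_mul_right x z) hζz
  obtain ⟨⟨u, rfl⟩, hζd, hmin⟩ := isLeftLub_pair_iff.mp hd
  have hu := h u (lub_mem_simples hx hζ hd)
    (dvd_of_mul_dvd_mul (hmin _ (dvd_mul_right _ _) hζz))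
  rwa [hu, mul_one] at hζd

theorem normalRel_of_forall {x y : ArtinTitsMonoid M} (hx : x ∈ simples M)
    (h : ∀ u, x * u ∈ simples M → u ∣ y → u = 1) : NormalRel x y :=
  (isHead_mul hx h).isLeftLub hx

theorem normalRel_of_gen_dvd {x y : ArtinTitsMonoid M} (hx : x ∈ simples M)
    (h : ∀ i, gen M i ∣ y → ∃ x', x = x' * gen M i) : NormalRel x y :=
  normalRel_of_forall hx fun _ hxu huy =>
    eq_one_of_mul_gen_mul_mem hxu fun i hi => h i (hi.trans huy)

/-- Normality is local: if `x * u` is simple with `u ∣ z`, then `u` is simple as a right divisor, so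
it divides the head `y` of `z`, and `x → y` already rules out `u ≠ 1`. -/
theorem NormalRel.isHead_mul {x y z : ArtinTitsMonoid M} (hx : x ∈ simples M)
    (hxy : NormalRel x y) (hyz : IsHead y z) : IsHead x (x * z) := by
  refine ArtinTitsMonoid.isHead_mul hx fun u hxu huz => ?_
  have huy := hyz.2 u (mem_simples_of_mul hxu) huz
  have h : x * u ∣ x := hxy.1 _ ⟨hxu, mul_dvd_mul_left x huy⟩
  obtain ⟨w, hw⟩ := h
  have := congrArg len hw
  rw [len_mul, len_mul] at this
  exact eq_one_of_len_eq_zero (by omega)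

theorem isNormalSeq_singleton {x : ArtinTitsMonoid M} (hx : x ∈ simples M) : IsNormalSeq [x] := by
  refine ⟨by simp, fun i hi => ?_⟩
  obtain rfl : i = 0 := by simpa using hi
  refine ⟨hx, IsHead.isLeftLub hx ?_⟩
  simp only [List.drop_zero, List.prod_singleton]
  exact ⟨dvd_rfl, fun _ _ h => h⟩

theorem IsNormalSeq.cons {x y : ArtinTitsMonoid M} {l : List (ArtinTitsMonoid M)}
    (hx : x ∈ simples M) (hxy : NormalRel x y) (hl : IsNormalSeq l) (hy : l.head? = some y) :
    IsNormalSeq (x :: l) := by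
  refine ⟨by simp, fun i hi => ?_⟩
  rcases i with _ | i
  · refine ⟨hx, IsHead.isLeftLub hx ?_⟩
    rcases l with _ | ⟨y', l⟩
    · simp at hy
    obtain rfl : y' = y := by simpa using hy
    have h0 := (hl.2 0 (by simp)).2
    simp only [List.drop_zero, List.prod_cons, List.getElem_cons_zero] at h0 ⊢
    exact NormalRel.isHead_mul hx hxy ⟨dvd_mul_right _ _, fun ζ hζ hζz => h0.1 ζ ⟨hζ, hζz⟩⟩
  · simpa using hl.2 i (by simpa using hi)

/-- Take `b` followed by the join `D` of those generators dividing `y` whose label with `b` is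
finite; the others cannot occur in a simple element with `b`. `D` is right divisible by its letters,
which gives the edge. A generator `c ≠ b` dividing `b D` is a letter of `D`, and must commute with
`b`, since otherwise the braid relation would put `b` into `D`. -/
theorem exists_normalRel {y : ArtinTitsMonoid M} [Finite B] {I : Set B}
    {b : B} (hb : b ∉ I) (hI : ∀ c, gen M c ∣ y → c ∈ I) :
    ∃ x ∈ simples M, x ≠ 1 ∧ NormalRel x y ∧
      ∀ c, gen M c ∣ x → c = b ∨ c ∈ I ∧ M b c = 2 := by
  set J : Finset B := (Set.toFinite {c | gen M c ∣ y ∧ M b c ≠ 0}).toFinset with hJdef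
  have hJ : ∀ c, c ∈ J ↔ gen M c ∣ y ∧ M b c ≠ 0 := fun c => by simp [hJdef]
  have hbJ : b ∉ J := fun h => hb (hI b ((hJ b).mp h).1)
  obtain ⟨D, hD, hs, hm⟩ := exists_lub_gens (gen_mem_simples b) J
    (fun c hc => gen_mul_gen_mem_simples (by rintro rfl; exact hbJ hc) ((hJ c).mp hc).2)
    fun c hc => ((hJ c).mp hc).1
  refine ⟨gen M b * D, hm, ?_, ?_, ?_⟩
  · intro h
    have := congrArg len h
    simp [len_mul] at this
  · refine normalRel_of_forall hm fun u hxu huy => eq_one_of_mul_gen_mul_mem hxu fun c hc => ?_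
    have hcJ : c ∈ J := (hJ c).mpr ⟨hc.trans huy, ne_zero_of_mem_simples hxu
      (by simp [supp_mul]) (by
        rw [supp_mul]
        exact Or.inr (supp_subset_of_dvd hc (by simp)))⟩
    obtain ⟨D', rfl⟩ := exists_eq_mul_gen_of_isLeftLub hD hs hcJ
    exact ⟨gen M b * D', by rw [mul_assoc]⟩
  · intro c hc
    by_cases hcb : c = b
    · exact Or.inl hcb
    obtain ⟨h0, hd⟩ := braid_dvd (Ne.symm hcb) (dvd_mul_right _ _) hc
    obtain ⟨p, hp, hcp, -, hbp⟩ := exists_braidElt_eq (Ne.symm hcb) h0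
    rw [← braidElt, hp] at hd
    have hpD := dvd_of_mul_dvd_mul hd
    have hcD : c ∈ J := hs (supp_subset_of_dvd (hcp.trans hpD) (by simp))
    refine Or.inr ⟨hI c ((hJ c).mp hcD).1, ?_⟩
    by_contra h2
    exact hbJ (hs (supp_subset_of_dvd hpD (hbp h2)))

variable (M) in
/-- The vertices of the Charney graph, as a predicate. -/
def IsVertex (x : ArtinTitsMonoid M) : Prop := x ∈ simples M ∧ x ≠ 1 ∧ ¬ IsGarsideElement x

theorem isVertex_of_not_dvd {x : ArtinTitsMonoid M} (hx : x ∈ simples M) (h1 : x ≠ 1) {c : B}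
    (hc : ¬ gen M c ∣ x) : IsVertex M x :=
  ⟨hx, h1, fun h => hc (h.1 _ ⟨c, rfl⟩)⟩

theorem exists_eq_mul_gen_of_isGarsideElement [Finite B] {d : ArtinTitsMonoid M}
    (hd : IsGarsideElement d) (i : B) : ∃ d', d = d' * gen M i := by
  classical
  have := Fintype.ofFinite B
  refine exists_eq_mul_gen_of_isLeftLub (J := Finset.univ) ?_ (by simp) (Finset.mem_univ i)
  rw [Finset.coe_univ, Set.image_univ]
  exact hd

/-- `x` is a multiple of the join of all generators, and since that join ends in every generator, no
proper multiple of it is simple. -/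
theorem isGarsideElement_of_gen_dvd [Finite B] [Nonempty B] {x : ArtinTitsMonoid M}
    (hx : x ∈ simples M) (h : ∀ c, gen M c ∣ x) : IsGarsideElement x := by
  classical
  have := Fintype.ofFinite B
  have h1 : (1 : ArtinTitsMonoid M) ∈ simples M :=
    mem_simples_of_mul (x := x) (y := 1) (by rwa [mul_one])
  obtain ⟨D, hD, -, -⟩ := exists_lub_gens h1 Finset.univ
    (fun i _ => by rw [one_mul]; exact gen_mem_simples i) fun c _ => h c
  rw [Finset.coe_univ, Set.image_univ] at hD
  obtain ⟨u, rfl⟩ : D ∣ x := hD.2 _ (by rintro _ ⟨c, rfl⟩; exact h c)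
  rw [eq_one_of_mul_gen_mul_mem hx fun i _ => exists_eq_mul_gen_of_isGarsideElement hD i, mul_one]
  exact hD

theorem IsVertex.exists_not_dvd [Finite B] [Nonempty B] {x : ArtinTitsMonoid M}
    (hx : IsVertex M x) : ∃ c, ¬ gen M c ∣ x := by
  by_contra! h
  exact hx.2.2 (isGarsideElement_of_gen_dvd hx.1 h)

variable (M) in
/-- The edges of the Charney graph, as a relation. -/
def CharneyEdge (x y : ArtinTitsMonoid M) : Prop := IsVertex M x ∧ IsVertex M y ∧ NormalRel x y

theorem eq_of_gen_dvd_gen {i j : B} (h : gen M i ∣ gen M j) : i = j := by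
  have := supp_subset_of_dvd h
  simpa using this

/-- Only an upper bound `I` for the generators dividing `y` is tracked, so that a move on sets
yields the claim for all `y` with this bound at once. -/
theorem reflTransGen_charneyEdge_of_forall_mem [Finite B] [Nonempty B]
    (hM : M.graph.Preconnected) {s : B} (hs : IsVertex M (gen M s)) {I : Set B}
    (hne : I.Nonempty) (huniv : I ≠ Set.univ) : ∀ y, IsVertex M y → (∀ c, gen M c ∣ y → c ∈ I) →
      Relation.ReflTransGen (CharneyEdge M) (gen M s) y := by
  have move : ∀ (I : Set B) (b : B), b ∉ I → (∃ p ∈ I, M.graph.Adj b p) →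
      (∀ y, IsVertex M y → (∀ c, gen M c ∣ y → c ∈ insert b {x ∈ I | ¬ M.graph.Adj b x}) →
        Relation.ReflTransGen (CharneyEdge M) (gen M s) y) →
      ∀ y, IsVertex M y → (∀ c, gen M c ∣ y → c ∈ I) →
        Relation.ReflTransGen (CharneyEdge M) (gen M s) y := by
    rintro I b hb ⟨p, hpI, hbp⟩ ih y hy hyI
    obtain ⟨x, hx, hx1, hxy, hL⟩ := exists_normalRel hb hyI
    -- The neighbour `p` of `b` does not divide the predecessor, which is thus not `Δ`.
    have hxv : IsVertex M x := isVertex_of_not_dvd hx hx1 (c := p) fun hp => by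
      rcases hL p hp with rfl | h
      · exact hb hpI
      · exact hbp.2 h.2
    refine (ih x hxv fun c hc => ?_).tail ⟨hxv, hy, hxy⟩
    rcases hL c hc with rfl | h
    · exact Or.inl rfl
    · exact Or.inr ⟨h.1, fun hadj => hadj.2 h.2⟩
  refine hM.move_induction (P := fun I => ∀ y, IsVertex M y → (∀ c, gen M c ∣ y → c ∈ I) →
    Relation.ReflTransGen (CharneyEdge M) (gen M s) y) (fun v => ?_) move hne huniv
  -- A singleton `{c}` is moved to `{b}` for a neighbour `b`, and so along a path to `{s}`; elements
  -- whose only left generator is `s` have an edge from `s`.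
  have hr := (M.graph.reachable_iff_reflTransGen s v).mp (hM s v)
  induction hr with
  | refl =>
    intro y hy hyI
    refine Relation.ReflTransGen.single ⟨hs, hy, normalRel_of_gen_dvd hs.1 fun i hi => ?_⟩
    exact ⟨1, by rw [one_mul, hyI i hi]⟩
  | @tail b c _ hbc ih =>
    refine move {c} b hbc.ne ⟨c, rfl, hbc⟩ fun y hy hyI => ih y hy fun a ha => ?_
    rcases hyI a ha with h | ⟨rfl, h⟩
    · exact h
    · exact absurd hbc h

/-- In the irreducible case, the Charney graph is strongly connected. -/
theorem IsIrreducible.reflTransGen_charneyEdge [Finite B] [Nonempty B] (hM : IsIrreducible M)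
    {x y : ArtinTitsMonoid M} (hx : IsVertex M x) (hy : IsVertex M y) :
    Relation.ReflTransGen (CharneyEdge M) x y := by
  obtain ⟨s, x', hs⟩ := exists_eq_mul_gen hx.2.1
  obtain ⟨c₀, hc₀⟩ := hy.exists_not_dvd
  obtain ⟨c₁, hc₁⟩ := exists_gen_dvd hy.2.1
  -- One generator divides `y` and another does not, so there are at least two; hence the generator
  -- `s` is not `Δ`.
  have hc : ∃ c, c ≠ s := by
    by_contra! h
    rw [h c₀, ← h c₁] at hc₀
    exact hc₀ hc₁
  obtain ⟨c, hcs⟩ := hc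
  have hsv : IsVertex M (gen M s) := isVertex_of_not_dvd (gen_mem_simples s) (gen_ne_one s)
    fun h => hcs (eq_of_gen_dvd_gen h)
  refine Relation.ReflTransGen.head ⟨hx, hsv, normalRel_of_gen_dvd hx.1 fun i hi => ?_⟩
    (reflTransGen_charneyEdge_of_forall_mem hM.preconnected_graph hsv
      (I := {c | gen M c ∣ y}) ⟨c₁, hc₁⟩ (fun h => hc₀ ?_) y hy fun _ h => h)
  · rw [eq_of_gen_dvd_gen hi]
    exact ⟨x', hs⟩
  · have : c₀ ∈ {c | gen M c ∣ y} := h ▸ Set.mem_univ c₀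
    exact this

theorem nonempty_path_of_reflTransGen {x y : ArtinTitsMonoid M} (hx : IsVertex M x)
    (hy : IsVertex M y) (h : Relation.ReflTransGen (CharneyEdge M) x y) :
    Nonempty (@Quiver.Path (CharneyGraph M) _ ⟨x, hx⟩ ⟨y, hy⟩) := by
  induction h with
  | refl => exact ⟨Quiver.Path.nil⟩
  | @tail y z _ hyz ih =>
    obtain ⟨p⟩ := ih hyz.1
    exact ⟨p.cons ⟨hyz.2.2⟩⟩

theorem exists_isNormalSeq_of_reflTransGen {x y : ArtinTitsMonoid M} (hy : y ∈ simples M)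
    (h : Relation.ReflTransGen (CharneyEdge M) x y) :
    ∃ l : List (ArtinTitsMonoid M), IsNormalSeq l ∧ l.head? = some x ∧ l.getLast? = some y := by
  induction h using Relation.ReflTransGen.head_induction_on with
  | refl => exact ⟨[y], isNormalSeq_singleton hy, rfl, rfl⟩
  | @head x z hxz _ ih =>
    obtain ⟨l, hl, h1, h2⟩ := ih
    refine ⟨x :: l, hl.cons hxz.1.1 hxz.2.2 h1, rfl, ?_⟩
    rw [List.getLast?_cons, h2]
    rfl

end ArtinTitsMonoid

theorem mainTheorem1 {B : Type u} [Finite B] [Nonempty B] (M : CoxeterMatrix B)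
    (hirr : ArtinTitsMonoid.IsIrreducible M) :
    Quiver.IsStronglyConnected (ArtinTitsMonoid.CharneyGraph M) ∧
    ∀ a ∈ ArtinTitsMonoid.simples M, ∀ b ∈ ArtinTitsMonoid.simples M, a ≠ 1 → b ≠ 1 →
      (¬ ArtinTitsMonoid.IsSpherical M ∨ ArtinTitsMonoid.IsGarsideElement a ∨
        ¬ ArtinTitsMonoid.IsGarsideElement b) →
      ∃ l : List (ArtinTitsMonoid M), ArtinTitsMonoid.IsNormalSeq l ∧
        l.head? = some a ∧ l.getLast? = some b := by
  refine ⟨fun x y => ArtinTitsMonoid.nonempty_path_of_reflTransGen x.2 y.2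
    (hirr.reflTransGen_charneyEdge x.2 y.2), fun a ha b hb ha1 hb1 h => ?_⟩
  by_cases hga : ArtinTitsMonoid.IsGarsideElement a
  -- Two terms suffice: `Δ` ends in every generator, so `Δ → b` for every simple `b`, including `Δ`.
  · refine ⟨[a, b], (ArtinTitsMonoid.isNormalSeq_singleton hb).cons ha ?_ rfl, rfl, rfl⟩
    exact ArtinTitsMonoid.normalRel_of_gen_dvd ha fun i _ =>
      ArtinTitsMonoid.exists_eq_mul_gen_of_isGarsideElement hga i
  · have hgb : ¬ ArtinTitsMonoid.IsGarsideElement b := by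
      rcases h with h | h | h
      · exact fun hb => h ⟨b, hb⟩
      · exact absurd h hga
      · exact h
    exact ArtinTitsMonoid.exists_isNormalSeq_of_reflTransGen hb
      (hirr.reflTransGen_charneyEdge ⟨ha, ha1, hga⟩ ⟨hb, hb1, hgb⟩)
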